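/- \textbf{Setting.} Let $\|\cdot\|$ be a norm on $\mathbb R^d$, $S\subseteq\mathbb R^d$ a polyhedron, and $w^*:\mathbb R^d\to S$ a (measurable) oracle such that $w^*(c)$ minimizes $c^\top w$ over $w\in S$, for every $c$. A cost vector is degenerate if this problem has several minimizers; $\nu_S(\hat c)$ is the distance in $\|\cdot\|$ of $\hat c$ to the set of degenerate vectors ($+\infty$ if there is none). Let $(x,c)\sim\mathcal D$ with $c\in\mathcal C$, $\mathcal C\subseteq\mathbb R^d$ bounded. The hypothesis class is $\mathcal H=\{h_\theta:\theta\in\Theta\}$ with $\Theta\subseteq\mathbb R^{k}$ bounded and $\|h_{\theta_1}(x)-h_{\theta_2}(x)\|_\infty\le L_1\|\theta_1-\theta_2\|_\infty$ for all $x$. The surrogate loss $\ell\ge 0$ is bounded on $\hat{\mathcal C}\times\mathcal C$, where $\hat{\mathcal C}$ is the set of predicted vectors $h(x)$, and $\ell(\cdot,c)$ is $L_2$-Lipschitz on $\hat{\mathcal C}$ for every $c\in\mathcal C$. Write $R_\ell(h)=\mathbb E[\ell(h(x),c)]$, $R_\ell^*=\min_{\mathcal H}R_\ell$, $\mathcal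 H_\ell^*$ for the set of minimizers of $R_\ell$ in $\mathcal H$, and $\mathcal H^*$ for the set of minimizers in $\mathcal H$ of the SPO risk $\mathbb E[c^\top w^*(h(x))-c^\top w^*(c)]$. Let $\|h\|_{\infty}$ (for predictors) be the essential supremum of $\|h(x)\|$, and $\mathrm{Dist}_{\mathcal H'}(h)=\inf_{h'\in\mathcal H'}\|h-h'\|_\infty$. \textbf{Assumptions.} (1) $\mathcal H$ is nonempty and compact for the sup norm; $\mathcal H_\ell^*$ is nonempty and $\mathcal H^*_\ell\subseteq\mathcal H^*$; there is a non-decreasing $\phi:\mathbb R_+\to\mathbb R_+$ with $\phi(0)=0$ and $\phi(\epsilon)\le O(\sqrt\epsilon)$ as $\epsilon\to0$ such that for all $h\in\mathcal H$ and $\epsilon>0$, $R_\ell(h)-R_\ell^*\le\epsilon$ implies $\mathrm{Dist}_{\mathcal H^*_\ell}(h)\le\phi(\epsilon)$. (2) There are $\kappa>0$, $\beta>0$ such that $\mathbb P(\inf_{h^*\in\mathcal H^*}\nu_S(h^*(x))\le b)\le(b/\beta)^\kappa$ for all $b\ge0$. \textbf{Algorithm} (horizon $T\ge1$, warm-up length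 $n_0\ge1$, $0<\underline\alpha\le\bar\alpha$). All samples $(x,c)$ are i.i.d.\ from $\mathcal D$. First $n_0$ labelled samples are collected; an initial threshold $b_0\ge0$ is chosen from what is then known, and $b_t=b_0\bigl(n_0\ln(n_0+t)/t\bigr)^{1/4}$ for $t\ge1$. After iteration $t\ge0$ a predictor $h_t\in\mathcal H$, a minimizer $h_t^*\in\mathcal H^*_\ell$ and $\alpha_t\in[\underline\alpha,\bar\alpha]$ are chosen from what is then known, where $h_t$ minimizes over $\mathcal H$ the empirical risk $\frac1{t+n_0}\sum \mathrm{weight}\cdot\ell(h(x),c)$ over the $n_0$ warm-up samples (weight $1$) and the samples of iterations $1,\dots,t$, weighted as follows. In iteration $t+1$ a sample $(x,c)$ is drawn. If $\nu_S(h_t(x))<b_t$, its label $c$ is acquired and its weight is $1$. Otherwise a coin is flipped with heads-up probability $\tilde p_t=\min\bigl\{1,\max\{T^{-\frac{\kappa}{2(\kappa+2)}},\ \alpha_t\|h_t(x)-h_t^*(x)\|\}\bigr\}$; on heads the label is acquired and the weight is $1/\tilde p_t$, on tails the sample is rejected (weight $0$). Let $n_T$ be the number of labels acquired in the warm-up and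 the first $T$ iterations. \textbf{Claim.} For all $B$ and $m_0\in\mathbb N$ there are $C>0$ and $m\in\mathbb N$, depending only on the above data (not on $T$, $\delta$, the choices made by the algorithm), such that for all $T\ge1$ and all $\delta\in(0,1]$: (a) with probability at least $1-\delta$, $\;R_\ell(h_T)-R_\ell^*\le C\,(1+\ln(T/\delta))^m\,T^{-1/2}$; (b) if each $h_t^*$ is an element of $\mathcal H_\ell^*$ closest to $h_t$ in $\|\cdot\|_\infty$ (no condition if the surrogate risk minimizer is unique), and $b_0\le B\,(1+\ln(T/\delta))^{m_0}\,T^{\frac{\kappa}{4(\kappa+2)}}$, then $\;\mathbb E[n_T]\le C\,(1+\ln(T/\delta))^m\,T^{1-\frac{\min\{\kappa,1\}}{2(\kappa+2)}}$. -/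

import Mathlib

open MeasureTheory ProbabilityTheory Filter Topology
open scoped ENNReal

/-! Contextual linear optimization, and margin-based active learning with soft rejections.
Vectors of `ℝ^d` are functions `Fin d → ℝ`, so that `‖·‖` is the `ℓ_∞` norm; the generic norm on
the space of cost vectors is a definite seminorm `N`. -/

namespace MBAL

noncomputable section

/-! ### The linear optimization problem -/

/-- A polyhedron: the solution set of finitely many affine inequalities. -/
def IsPolyhedron {d : ℕ} (S : Set (Fin d → ℝ)) : Prop :=
  ∃ (m : ℕ) (a : Fin m → Fin d → ℝ) (β : Fin m → ℝ), S = {w | ∀ i, a i ⬝ᵥ w ≤ β i}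

/-- `w` is an optimal solution of `min_{w ∈ S} cᵀ w`. -/
def IsOptimal {d : ℕ} (S : Set (Fin d → ℝ)) (c w : Fin d → ℝ) : Prop :=
  w ∈ S ∧ ∀ w' ∈ S, c ⬝ᵥ w ≤ c ⬝ᵥ w'

/-- The degenerate cost vectors: those with several optimal solutions. -/
def degenerate {d : ℕ} (S : Set (Fin d → ℝ)) : Set (Fin d → ℝ) :=
  {c | ∃ w₁ w₂, IsOptimal S c w₁ ∧ IsOptimal S c w₂ ∧ w₁ ≠ w₂}

/-- Distance to degeneracy `ν_S` with respect to the norm `N`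
(`∞` if there is no degenerate cost vector, that is, if `S` is a single point). -/
def nu {d : ℕ} (N : Seminorm ℝ (Fin d → ℝ)) (S : Set (Fin d → ℝ)) (c : Fin d → ℝ) : ℝ≥0∞ :=
  ⨅ c' ∈ degenerate S, ENNReal.ofReal (N (c' - c))

/-- The SPO loss of the oracle `wstar`. -/
def spoLoss {d : ℕ} (wstar : (Fin d → ℝ) → Fin d → ℝ) (chat c : Fin d → ℝ) : ℝ :=
  c ⬝ᵥ wstar chat - c ⬝ᵥ wstar c

/-! ### Risks, optimal predictors, distances between predictors -/

section Risk

variable {𝒳 : Type*} [MeasurableSpace 𝒳] {d : ℕ}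

/-- The risk `R_ℓ(h) = 𝔼_{(x,c) ∼ D} [ℓ(h(x), c)]`. -/
def risk (D : Measure (𝒳 × (Fin d → ℝ))) (l : (Fin d → ℝ) → (Fin d → ℝ) → ℝ)
    (h : 𝒳 → Fin d → ℝ) : ℝ :=
  ∫ z, l (h z.1) z.2 ∂D

/-- The optimal risk over the class `H`. -/
def optRisk (D : Measure (𝒳 × (Fin d → ℝ))) (l : (Fin d → ℝ) → (Fin d → ℝ) → ℝ)
    (H : Set (𝒳 → Fin d → ℝ)) : ℝ :=
  sInf (risk D l '' H)

/-- The set of risk minimizers in the class `H`. -/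
def optSet (D : Measure (𝒳 × (Fin d → ℝ))) (l : (Fin d → ℝ) → (Fin d → ℝ) → ℝ)
    (H : Set (𝒳 → Fin d → ℝ)) : Set (𝒳 → Fin d → ℝ) :=
  {h | h ∈ H ∧ ∀ h' ∈ H, risk D l h ≤ risk D l h'}

/-- The essential sup norm of `g` with respect to the law `μ` of the feature vector. -/
def essNorm (N : Seminorm ℝ (Fin d → ℝ)) (μ : Measure 𝒳) (g : 𝒳 → Fin d → ℝ) : ℝ :=
  sInf {a : ℝ | 0 ≤ a ∧ ∀ᵐ x ∂μ, N (g x) ≤ a}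

/-- `Dist_{H'}(h)`: the distance of `h` to the set `H'` in the essential sup norm. -/
def essDist (N : Seminorm ℝ (Fin d → ℝ)) (μ : Measure 𝒳) (H' : Set (𝒳 → Fin d → ℝ))
    (h : 𝒳 → Fin d → ℝ) : ℝ :=
  sInf ((fun h' => essNorm N μ (fun x => h x - h' x)) '' H')

/-- The near-degeneracy function `Ψ(b) = ℙ(inf_{h ∈ Hopt} ν_S(h(x)) ≤ b)`. -/
def nearDegeneracy (N : Seminorm ℝ (Fin d → ℝ)) (S : Set (Fin d → ℝ)) (μ : Measure 𝒳)
    (Hopt : Set (𝒳 → Fin d → ℝ)) (b : ℝ) : ℝ :=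
  μ.real {x | ⨅ h ∈ Hopt, nu N S (h x) ≤ ENNReal.ofReal b}

/-- Consistency and error bound condition for the class `H` and the surrogate loss `l`,
with an error bound function `φ` that is `O(√ε)`. -/
structure ConsistencyErrorBound (N : Seminorm ℝ (Fin d → ℝ)) (D : Measure (𝒳 × (Fin d → ℝ)))
    (wstar : (Fin d → ℝ) → Fin d → ℝ) (l : (Fin d → ℝ) → (Fin d → ℝ) → ℝ)
    (H : Set (𝒳 → Fin d → ℝ)) (φ : ℝ → ℝ) : Prop where
  /-- `H` is nonempty. -/
  nonempty : H.Nonempty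
  /-- `H` is compact for uniform convergence. -/
  compact : IsCompact (UniformFun.ofFun '' H)
  /-- The surrogate risk has a minimizer in `H`. -/
  exists_opt : (optSet D l H).Nonempty
  /-- Minimizers of the surrogate risk minimize the SPO risk. -/
  consistent : optSet D l H ⊆ optSet D (spoLoss wstar) H
  phi_zero : φ 0 = 0
  phi_mono : MonotoneOn φ (Set.Ici 0)
  phi_sqrt : φ =O[𝓝[>] 0] Real.sqrt
  error_bound : ∀ h ∈ H, ∀ ε > 0, risk D l h - optRisk D l H ≤ ε →
    essDist N (D.map Prod.fst) (optSet D l H) h ≤ φ ε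

end Risk

/-! ### The algorithm -/

/-- The rejection threshold `b_t = b₀ (n₀ ln(n₀ + t) / t)^{1/4}` after iteration `t ≥ 1`,
which is `b₀` for `t = 0`. -/
def threshold (b₀ : ℝ) (n₀ t : ℕ) : ℝ :=
  if t = 0 then b₀ else b₀ * ((n₀ : ℝ) * Real.log ((n₀ : ℝ) + t) / t) ^ (1 / 4 : ℝ)

/-- The adaptive soft-rejection probability `max {T^{-κ/(2(κ+2))}, α r}`, capped at `1`;
here `r` stands for a prediction error `‖h(x) - h*(x)‖`. -/
def softProb (κ : ℝ) (T : ℕ) (α r : ℝ) : ℝ :=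
  min 1 (max ((T : ℝ) ^ (-(κ / (2 * (κ + 2))))) (α * r))

/-- The random quantities of one execution of the algorithm. Iteration `t + 1` uses the sample
`sample (t + 1)`, the number `coin (t + 1)`, and what is indexed by `t`. -/
structure Run (Ω : Type*) [MeasurableSpace Ω] (𝒳 : Type*) (d k n₀ : ℕ) where
  /-- All that is known after each iteration. -/
  hist : Filtration ℕ (inferInstance : MeasurableSpace Ω)
  /-- The `n₀` labelled samples of the warm-up period. -/
  warmup : Fin n₀ → Ω → 𝒳 × (Fin d → ℝ)
  /-- The sample (feature vector, cost vector) of each iteration. -/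
  sample : ℕ → Ω → 𝒳 × (Fin d → ℝ)
  /-- Uniform random numbers: a coin of heads-up probability `p` shows heads
  if the number is at most `p`. -/
  coin : ℕ → Ω → ℝ
  /-- The parameter of the predictor `h_t`. -/
  θ : ℕ → Ω → Fin k → ℝ
  /-- The parameter of the surrogate risk minimizer with which `h_t` is compared. -/
  θstar : ℕ → Ω → Fin k → ℝ
  /-- The scale `α_t` of the adaptive soft-rejection probability. -/
  α : ℕ → Ω → ℝ
  /-- The initial rejection threshold. -/
  b₀ : Ω → ℝ

namespace Run

variable {Ω : Type*} [MeasurableSpace Ω] {𝒳 : Type*} {d k n₀ : ℕ}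

/-- The soft-rejection probability of iteration `t + 1`:
`max {T^{-κ/(2(κ+2))}, α_t ‖h_t(x) - h*(x)‖}` at the feature vector `x` of that iteration. -/
def prob (R : Run Ω 𝒳 d k n₀) (N : Seminorm ℝ (Fin d → ℝ)) (h : (Fin k → ℝ) → 𝒳 → Fin d → ℝ)
    (κ : ℝ) (T t : ℕ) (ω : Ω) : ℝ :=
  softProb κ T (R.α t ω)
    (N (h (R.θ t ω) (R.sample (t + 1) ω).1 - h (R.θstar t ω) (R.sample (t + 1) ω).1))

/-- Iteration `t + 1` draws a near-degenerate feature vector: `ν_S(h_t(x)) < b_t`. -/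
def nearMargin (R : Run Ω 𝒳 d k n₀) (N : Seminorm ℝ (Fin d → ℝ)) (S : Set (Fin d → ℝ))
    (h : (Fin k → ℝ) → 𝒳 → Fin d → ℝ) (t : ℕ) (ω : Ω) : Prop :=
  nu N S (h (R.θ t ω) (R.sample (t + 1) ω).1) < ENNReal.ofReal (threshold (R.b₀ ω) n₀ t)

/-- The coin of iteration `t + 1` shows heads. -/
def heads (R : Run Ω 𝒳 d k n₀) (N : Seminorm ℝ (Fin d → ℝ)) (h : (Fin k → ℝ) → 𝒳 → Fin d → ℝ)
    (κ : ℝ) (T t : ℕ) (ω : Ω) : Prop :=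
  R.coin (t + 1) ω ≤ R.prob N h κ T t ω

open Classical in
/-- The importance weight that the sample of iteration `t + 1` gets in the training set:
`1` near degeneracy, otherwise `1 / p̃` if the coin shows heads, and `0` if it is rejected. -/
def weight (R : Run Ω 𝒳 d k n₀) (N : Seminorm ℝ (Fin d → ℝ)) (S : Set (Fin d → ℝ))
    (h : (Fin k → ℝ) → 𝒳 → Fin d → ℝ) (κ : ℝ) (T t : ℕ) (ω : Ω) : ℝ :=
  if R.nearMargin N S h t ω then 1
  else if R.heads N h κ T t ω then 1 / R.prob N h κ T t ω else 0

/-- The re-weighted empirical risk after iteration `t` of the predictor with parameter `θ'`. -/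
def empRisk (R : Run Ω 𝒳 d k n₀) (N : Seminorm ℝ (Fin d → ℝ)) (S : Set (Fin d → ℝ))
    (l : (Fin d → ℝ) → (Fin d → ℝ) → ℝ) (h : (Fin k → ℝ) → 𝒳 → Fin d → ℝ)
    (κ : ℝ) (T t : ℕ) (ω : Ω) (θ' : Fin k → ℝ) : ℝ :=
  (1 / ((t : ℝ) + n₀)) *
    (∑ i, l (h θ' (R.warmup i ω).1) (R.warmup i ω).2 +
      ∑ s ∈ Finset.range t, R.weight N S h κ T s ω *
        l (h θ' (R.sample (s + 1) ω).1) (R.sample (s + 1) ω).2)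

open Classical in
/-- The number `n_t` of labels acquired until the end of iteration `t`, warm-up included. -/
def numLabels (R : Run Ω 𝒳 d k n₀) (N : Seminorm ℝ (Fin d → ℝ)) (S : Set (Fin d → ℝ))
    (h : (Fin k → ℝ) → 𝒳 → Fin d → ℝ) (κ : ℝ) (T t : ℕ) (ω : Ω) : ℝ :=
  (n₀ : ℝ) + ∑ s ∈ Finset.range t,
    if R.nearMargin N S h s ω ∨ R.heads N h κ T s ω then 1 else 0

/-- `R` is an execution of the margin-based active learning algorithm with horizon `T`
on independent samples of the law `D`. -/
structure IsExecution [MeasurableSpace 𝒳] (R : Run Ω 𝒳 d k n₀) (P : Measure Ω)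
    (D : Measure (𝒳 × (Fin d → ℝ))) (N : Seminorm ℝ (Fin d → ℝ)) (S : Set (Fin d → ℝ))
    (l : (Fin d → ℝ) → (Fin d → ℝ) → ℝ) (Θ : Set (Fin k → ℝ))
    (h : (Fin k → ℝ) → 𝒳 → Fin d → ℝ) (κ αlo αhi : ℝ) (T : ℕ) : Prop where
  /-- The warm-up samples are known at time `0`, independent, and distributed as `D`. -/
  warmup_meas : ∀ i, Measurable[R.hist 0] (R.warmup i)
  warmup_law : ∀ i, P.map (R.warmup i) = D
  warmup_indep : iIndepFun R.warmup P
  /-- The sample and the coin of an iteration are known at its end, independent of the past,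
  and have law `D ⊗ Unif[0, 1]`. -/
  sample_meas : ∀ t, Measurable[R.hist (t + 1)] (R.sample (t + 1))
  coin_meas : ∀ t, Measurable[R.hist (t + 1)] (R.coin (t + 1))
  law : ∀ t, P.map (fun ω => (R.sample (t + 1) ω, R.coin (t + 1) ω)) =
    D.prod (volume.restrict (Set.Icc (0 : ℝ) 1))
  indep : ∀ t, Indep (MeasurableSpace.comap
    (fun ω => (R.sample (t + 1) ω, R.coin (t + 1) ω)) inferInstance) (R.hist t) P
  /-- The initial threshold is chosen after the warm-up period. -/
  b₀_meas : Measurable[R.hist 0] R.b₀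
  b₀_nonneg : ∀ ω, 0 ≤ R.b₀ ω
  /-- The scales are chosen in `[αlo, αhi]` from what is known. -/
  α_meas : ∀ t, Measurable[R.hist t] (R.α t)
  α_mem : ∀ t ω, R.α t ω ∈ Set.Icc αlo αhi
  /-- The predictor minimizes the re-weighted empirical risk over the class. -/
  θ_meas : ∀ t, Measurable[R.hist t] (R.θ t)
  θ_mem : ∀ t ω, R.θ t ω ∈ Θ
  θ_argmin : ∀ t, ∀ᵐ ω ∂P, ∀ θ' ∈ Θ,
    R.empRisk N S l h κ T t ω (R.θ t ω) ≤ R.empRisk N S l h κ T t ω θ'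
  /-- `h*` is a minimizer of the surrogate risk over the class. -/
  θstar_meas : ∀ t, Measurable[R.hist t] (R.θstar t)
  θstar_mem : ∀ t ω, R.θstar t ω ∈ Θ
  θstar_opt : ∀ t ω, h (R.θstar t ω) ∈ optSet D l (h '' Θ)

/-- The minimizer `h*` used along the run is always one that is closest to `h_t`
(no condition if the minimizer is unique). -/
def StarClosest [MeasurableSpace 𝒳] (R : Run Ω 𝒳 d k n₀)
    (D : Measure (𝒳 × (Fin d → ℝ))) (N : Seminorm ℝ (Fin d → ℝ))
    (l : (Fin d → ℝ) → (Fin d → ℝ) → ℝ) (Θ : Set (Fin k → ℝ))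
    (h : (Fin k → ℝ) → 𝒳 → Fin d → ℝ) : Prop :=
  ∀ t ω, essNorm N (D.map Prod.fst) (fun x => h (R.θ t ω) x - h (R.θstar t ω) x) =
    essDist N (D.map Prod.fst) (optSet D l (h '' Θ)) (h (R.θ t ω))

end Run

end

end MBAL

namespace MBAL

/-! ### General facts -/

/-! Write `A = T ^ (κ / (2 * (κ + 2)))`, the largest possible importance weight, and `Λ = 1 + log (T
/ δ)`. Everything rests on a fast rate that holds at every time `t ≤ T`: with high probability the
excess surrogate risk of `h_t` is at most a constant times `Λ * A / t` (`exists_fast_rate`).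

The fast rate comes from a pointwise Bernstein condition. Since `φ` is `O(√ε)`, a predictor of
excess risk `ε > 0` has, almost surely, predictions within order `√ε` of those of some surrogate
minimizer. By Lipschitz continuity the loss difference `g` to that minimizer satisfies `g ^ 2 ≤ K *
𝔼 g`, where `𝔼 g = ε` (`exists_comparator`). Conditionally on the past, a weight `w` is unbiased and
`w * g` has second moment at most `A * 𝔼 g ^ 2`. So with `r` a small multiple of `1 / A` each
iteration multiplies the exponential moment of `-r ∑ w g` by at most `1 - r ε + r² A K ε ≤ exp (-r ε
/ 2)` (`lintegral_exp_stepWeight_le`). This holds whatever the algorithm chose, so the factors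
multiply along the run. Markov's inequality then shows that a fixed parameter of excess risk well
above `Λ * A / t` is unlikely to have a small weighted sum, which an empirical risk minimizer must
have. A union bound over a net of mesh `1 / T ^ 2` finishes the argument.

The risk bound is the case `t = T`, because `A / T ≤ T ^ (-1/2)`. For the labels, the error bound
turns the fast rate into a bound on `‖h_t - h_t^*‖`, logarithms aside, of order `y = √A * t ^
(-1/4)`, and the assumption on `b₀` gives `b_t` the same order. As `ν_S` is 1-Lipschitz, a point
near the margin for `h_t` is near it for `h_t^*`, which is SPO-optimal by consistency. The margin
condition bounds this probability by order `y ^ κ'`, `κ' = min κ 1`; the coin costs the floor `1 /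
A` plus order `y ^ κ'` (`measure_label_le`). Summing over `t` gives the exponent, since `κκ' /
(4(κ+2)) - κ' / 4 = -κ' / (2(κ+2))` (`sum_label_le`). -/

/-- The freezing lemma: it replaces conditional expectations given the past by Fubini for a product
law. -/
theorem lintegral_indepFun {Ω α β : Type*} [MeasurableSpace Ω] [MeasurableSpace α]
    [MeasurableSpace β] {P : Measure Ω} [IsProbabilityMeasure P] {Y : Ω → α} {Z : Ω → β}
    (hY : Measurable Y) (hZ : Measurable Z) (hYZ : IndepFun Y Z P) {f : α × β → ℝ≥0∞}
    (hf : Measurable f) :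
    ∫⁻ ω, f (Y ω, Z ω) ∂P = ∫⁻ ω, ∫⁻ z, f (Y ω, z) ∂(P.map Z) ∂P := by
  have hmap := (indepFun_iff_map_prod_eq_prod_map_map hY.aemeasurable hZ.aemeasurable).1 hYZ
  have : IsProbabilityMeasure (P.map Z) := Measure.isProbabilityMeasure_map hZ.aemeasurable
  rw [← lintegral_map (f := f) hf (hY.prodMk hZ), hmap, lintegral_prod _ hf.aemeasurable,
    lintegral_map hf.lintegral_prod_right' hY]

theorem exp_le_one_add_add_sq {y : ℝ} (hy : |y| ≤ 1) : Real.exp y ≤ 1 + y + y ^ 2 := by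
  have := (abs_le.1 (Real.abs_exp_sub_one_sub_id_le hy)).2
  linarith

/-- Comparison with the integral of `x ^ (-s)`, done by induction: Bernoulli's inequality for the
exponent `1 - s ≤ 1` shows that `n ^ (1 - s)` grows by at least `(1 - s) * (n + 1) ^ (-s)`. -/
theorem sum_rpow_neg_le {s : ℝ} (hs₀ : 0 ≤ s) (hs₁ : s < 1) (T : ℕ) :
    ∑ t ∈ Finset.range T, ((t : ℝ) + 1) ^ (-s) ≤ (T : ℝ) ^ (1 - s) / (1 - s) := by
  have h1s : 0 < 1 - s := by linarith
  induction T with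
  | zero => simp [Real.zero_rpow h1s.ne']
  | succ n ih =>
    rw [Finset.sum_range_succ]
    have hn : (0 : ℝ) < n + 1 := by positivity
    have hb := rpow_one_add_le_one_add_mul_self (s := -(1 / ((n : ℝ) + 1)))
      (by rw [neg_le_neg_iff, div_le_one hn]; linarith [n.cast_nonneg (α := ℝ)])
      h1s.le (by linarith : 1 - s ≤ 1)
    have h1 : (n : ℝ) ^ (1 - s) = (n + 1) ^ (1 - s) * (1 + -(1 / ((n : ℝ) + 1))) ^ (1 - s) := by
      rw [← Real.mul_rpow hn.le]
      · congr 1; field_simp; ring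
      · rw [← sub_eq_add_neg, sub_nonneg, div_le_one hn]; linarith [n.cast_nonneg (α := ℝ)]
    have h2 : ((n : ℝ) + 1) ^ (-s) = (n + 1) ^ (1 - s) / (n + 1) := by
      rw [← Real.rpow_sub_one hn.ne']; congr 1; ring
    have hpow : 0 ≤ ((n : ℝ) + 1) ^ (1 - s) := by positivity
    have h3 : (n : ℝ) ^ (1 - s) ≤ (n + 1) ^ (1 - s) - (1 - s) * ((n : ℝ) + 1) ^ (-s) := by
      rw [h1, h2]
      refine (mul_le_mul_of_nonneg_left hb hpow).trans (le_of_eq ?_)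
      field_simp; ring
    push_cast
    rw [le_div_iff₀ h1s] at ih ⊢
    nlinarith

/-- Cut space into cubes of side `η` and keep one point of `Θ` from each cube that meets `Θ`. The
net must lie inside `Θ`, because the hypotheses on predictors hold only there. -/
theorem exists_finite_net {k : ℕ} {Θ : Set (Fin k → ℝ)} (hΘ : Bornology.IsBounded Θ) :
    ∃ K : ℝ, 1 ≤ K ∧ ∀ η : ℝ, 0 < η → η ≤ 1 → ∃ F : Finset (Fin k → ℝ),
      (∀ θ ∈ F, θ ∈ Θ) ∧ (F.card : ℝ) ≤ (K / η) ^ k ∧ ∀ θ ∈ Θ, ∃ θ' ∈ F, ‖θ - θ'‖ ≤ η := by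
  classical
  obtain ⟨r, hr⟩ := hΘ.exists_norm_le
  refine ⟨2 * |r| + 2, by linarith [abs_nonneg r], fun η hη hη1 => ?_⟩
  let cell : (Fin k → ℝ) → Fin k → ℤ := fun θ i => ⌊θ i / η⌋
  let rep : (Fin k → ℤ) → Fin k → ℝ := fun c =>
    if hc : ∃ θ ∈ Θ, cell θ = c then hc.choose else 0
  let box : Finset (Fin k → ℤ) := Fintype.piFinset fun _ => Finset.Icc ⌊-|r| / η⌋ ⌊|r| / η⌋
  have hrep : ∀ c, (∃ θ ∈ Θ, cell θ = c) → rep c ∈ Θ ∧ cell (rep c) = c := by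
    intro c hc
    simp only [rep, dif_pos hc]
    exact hc.choose_spec
  refine ⟨(box.filter fun c => ∃ θ ∈ Θ, cell θ = c).image rep, ?_, ?_, ?_⟩
  · intro θ hθ
    obtain ⟨c, hc, rfl⟩ := Finset.mem_image.1 hθ
    exact (hrep c (Finset.mem_filter.1 hc).2).1
  · have h1 : (((box.filter fun c => ∃ θ ∈ Θ, cell θ = c).image rep).card : ℝ) ≤ box.card := by
      exact_mod_cast Finset.card_image_le.trans (Finset.card_filter_le _ _)
    refine h1.trans ?_
    have hle : ⌊-|r| / η⌋ ≤ ⌊|r| / η⌋ := by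
      apply Int.floor_le_floor
      gcongr
      linarith [abs_nonneg r]
    have h2 : ((⌊|r| / η⌋ + 1 - ⌊-|r| / η⌋).toNat : ℝ) ≤ (2 * |r| + 2) / η := by
      have h3 : (((⌊|r| / η⌋ + 1 - ⌊-|r| / η⌋).toNat : ℤ) : ℝ)
          = (⌊|r| / η⌋ : ℝ) + 1 - ⌊-|r| / η⌋ := by
        rw [Int.toNat_of_nonneg (by omega)]; push_cast; ring
      have h4 := Int.floor_le (|r| / η)
      have h5 := Int.lt_floor_add_one (-|r| / η)
      have h6 : 1 ≤ 1 / η := by rw [le_div_iff₀ hη]; linarith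
      have h7 : (2 * |r| + 2) / η = |r| / η - (-|r| / η) + 2 * (1 / η) := by ring
      rw [Int.cast_natCast] at h3
      rw [h3, h7]
      linarith
    simp only [box, Fintype.card_piFinset, Int.card_Icc, Finset.prod_const, Finset.card_univ,
      Fintype.card_fin, Nat.cast_pow]
    gcongr
  · intro θ hθ
    have hc : ∃ θ' ∈ Θ, cell θ' = cell θ := ⟨θ, hθ, rfl⟩
    obtain ⟨hmem, hcell⟩ := hrep _ hc
    refine ⟨rep (cell θ), Finset.mem_image.2 ⟨cell θ, Finset.mem_filter.2 ⟨?_, hc⟩, rfl⟩, ?_⟩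
    · refine Fintype.mem_piFinset.2 fun i => Finset.mem_Icc.2 ?_
      have hi : |θ i| ≤ |r| := ((norm_le_pi_norm θ i).trans (hr θ hθ)).trans (le_abs_self r)
      obtain ⟨h1, h2⟩ := abs_le.1 hi
      constructor <;> apply Int.floor_le_floor <;> gcongr
    · refine (pi_norm_le_iff_of_nonneg hη.le).2 fun i => ?_
      have h1 := Int.abs_sub_lt_one_of_floor_eq_floor (congrFun hcell i)
      rw [← sub_div, abs_div, abs_of_pos hη, div_lt_one hη] at h1
      rw [Pi.sub_apply, norm_sub_rev]
      exact h1.le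

/-- Used on probabilities: the cap at `1` allows the exponent to be lowered even where `y > 1`. -/
theorem min_one_rpow_le {y κ κ' : ℝ} (hy : 0 ≤ y) (hκ' : 0 < κ') (hκ : κ' ≤ κ) :
    min 1 (y ^ κ) ≤ y ^ κ' := by
  rcases le_total 1 y with h | h
  · exact (min_le_left _ _).trans (Real.one_le_rpow h hκ'.le)
  · refine (min_le_right _ _).trans ?_
    rcases hy.eq_or_lt with rfl | h0
    · rw [Real.zero_rpow hκ'.ne', Real.zero_rpow (hκ'.trans_le hκ).ne']
    · exact Real.rpow_le_rpow_of_exponent_ge h0 h hκ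

/-! ### Norms on `ℝ^d` -/

theorem exists_seminorm_le {d : ℕ} (N : Seminorm ℝ (Fin d → ℝ)) :
    ∃ K : ℝ, 0 ≤ K ∧ ∀ v, N v ≤ K * ‖v‖ := by
  refine ⟨∑ i, N (Pi.single i 1), Finset.sum_nonneg fun i _ => apply_nonneg N _, fun v => ?_⟩
  have hv : v = ∑ i, v i • (Pi.single i 1 : Fin d → ℝ) := by
    ext j
    simp [Finset.sum_apply, Pi.single_apply]
  calc N v = N (∑ i, v i • (Pi.single i 1 : Fin d → ℝ)) := by rw [← hv]
    _ ≤ ∑ i, N (v i • (Pi.single i 1 : Fin d → ℝ)) :=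
      Finset.le_sum_of_subadditive N (map_zero N).le (map_add_le_add N) _ _
    _ ≤ ∑ i, N (Pi.single i 1) * ‖v‖ := by
      refine Finset.sum_le_sum fun i _ => ?_
      rw [map_smul_eq_mul, mul_comm]
      exact mul_le_mul_of_nonneg_left (norm_le_pi_norm v i) (apply_nonneg N _)
    _ = _ := by rw [Finset.sum_mul]

theorem continuous_seminorm {d : ℕ} (N : Seminorm ℝ (Fin d → ℝ)) : Continuous N := by
  obtain ⟨K, hK, hN⟩ := exists_seminorm_le N
  refine (LipschitzWith.of_dist_le_mul (K := K.toNNReal) fun u v => ?_).continuous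
  rw [Real.coe_toNNReal K hK, Real.dist_eq, dist_eq_norm]
  exact (abs_sub_map_le_sub N u v).trans (hN _)

theorem exists_norm_le_seminorm {d : ℕ} (N : Seminorm ℝ (Fin d → ℝ)) (hN : ∀ v, N v = 0 → v = 0) :
    ∃ K : ℝ, 0 < K ∧ ∀ v, ‖v‖ ≤ K * N v := by
  -- The sphere is empty when `d = 0`; otherwise the constant is the inverse of the minimum of `N`
  -- on it.
  rcases (Metric.sphere (0 : Fin d → ℝ) 1).eq_empty_or_nonempty with he | hne
  · refine ⟨1, one_pos, fun v => ?_⟩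
    have hv : v = 0 := by
      by_contra hv
      have : ‖v‖⁻¹ • v ∈ Metric.sphere (0 : Fin d → ℝ) 1 := by
        simp [norm_smul, hv]
      rw [he] at this
      exact this
    simp [hv]
  · obtain ⟨u, hu, hmin⟩ := (isCompact_sphere (0 : Fin d → ℝ) 1).exists_isMinOn hne
      (continuous_seminorm N).continuousOn
    have hu1 : ‖u‖ = 1 := by simpa using hu
    have hpos : 0 < N u := lt_of_le_of_ne (apply_nonneg N u) fun h0 => by
      rw [hN u h0.symm, norm_zero] at hu1
      exact one_ne_zero hu1.symm
    refine ⟨(N u)⁻¹, inv_pos.2 hpos, fun v => ?_⟩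
    rcases eq_or_ne v 0 with rfl | hv
    · simp
    have hv0 : 0 < ‖v‖ := norm_pos_iff.2 hv
    have hmem : ‖v‖⁻¹ • v ∈ Metric.sphere (0 : Fin d → ℝ) 1 := by
      simp [norm_smul, hv]
    have h1 : N u ≤ N (‖v‖⁻¹ • v) := hmin hmem
    rw [map_smul_eq_mul, norm_inv, norm_norm, inv_mul_eq_div, le_div_iff₀ hv0] at h1
    rw [inv_mul_eq_div, le_div_iff₀ hpos]
    linarith

/-! ### Distance to degeneracy -/

/-- An infimum of continuous functions is upper semicontinuous, even over an uncountable family. -/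
theorem measurable_nu {d : ℕ} (N : Seminorm ℝ (Fin d → ℝ)) (S : Set (Fin d → ℝ)) :
    Measurable (nu N S) := by
  refine UpperSemicontinuous.measurable ?_
  unfold nu
  refine upperSemicontinuous_biInf fun c' _ => Continuous.upperSemicontinuous ?_
  exact ENNReal.continuous_ofReal.comp
    ((continuous_seminorm N).comp (continuous_const.sub continuous_id))

theorem nu_le_nu_add {d : ℕ} (N : Seminorm ℝ (Fin d → ℝ)) (S : Set (Fin d → ℝ))
    (u v : Fin d → ℝ) : nu N S v ≤ nu N S u + ENNReal.ofReal (N (u - v)) := by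
  unfold nu
  simp only [ENNReal.iInf_add]
  refine le_iInf₂ fun c' hc' => (iInf₂_le c' hc').trans ?_
  rw [← ENNReal.ofReal_add (apply_nonneg N _) (apply_nonneg N _)]
  apply ENNReal.ofReal_le_ofReal
  have := map_add_le_add N (c' - u) (u - v)
  rwa [sub_add_sub_cancel] at this

/-! ### Essential sup norm -/

/-- The bound `b` excludes the default value `sInf ∅ = 0`, and the strict inequality spares showing
that the infimum is attained. -/
theorem ae_le_of_essNorm_lt {𝒳 : Type*} [MeasurableSpace 𝒳] {d : ℕ} {N : Seminorm ℝ (Fin d → ℝ)}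
    {μ : Measure 𝒳} {g : 𝒳 → Fin d → ℝ} {b a : ℝ} (hb : ∀ x, N (g x) ≤ b)
    (ha : essNorm N μ g < a) : ∀ᵐ x ∂μ, N (g x) ≤ a := by
  have hne : {a : ℝ | 0 ≤ a ∧ ∀ᵐ x ∂μ, N (g x) ≤ a}.Nonempty :=
    ⟨max b 0, le_max_right _ _, Eventually.of_forall fun x => (hb x).trans (le_max_left _ _)⟩
  obtain ⟨a', ⟨-, ha'⟩, hlt⟩ := exists_lt_of_csInf_lt hne ha
  exact ha'.mono fun x hx => hx.trans hlt.le

theorem essNorm_nonneg {𝒳 : Type*} [MeasurableSpace 𝒳] {d : ℕ} (N : Seminorm ℝ (Fin d → ℝ))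
    (μ : Measure 𝒳) (g : 𝒳 → Fin d → ℝ) : 0 ≤ essNorm N μ g :=
  Real.sInf_nonneg fun _ ha => ha.1

theorem essNorm_le {𝒳 : Type*} [MeasurableSpace 𝒳] {d : ℕ} {N : Seminorm ℝ (Fin d → ℝ)}
    {μ : Measure 𝒳} {g : 𝒳 → Fin d → ℝ} {b : ℝ} (hb₀ : 0 ≤ b) (hb : ∀ x, N (g x) ≤ b) :
    essNorm N μ g ≤ b :=
  csInf_le ⟨0, fun _ ha => ha.1⟩ ⟨hb₀, Eventually.of_forall hb⟩

/-! ### The soft-rejection probability -/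

theorem softProb_le_one (κ : ℝ) (T : ℕ) (α r : ℝ) : softProb κ T α r ≤ 1 := min_le_left _ _

theorem rpow_neg_le_softProb {κ : ℝ} (hκ : 0 < κ) {T : ℕ} (hT : 1 ≤ T) (α r : ℝ) :
    (T : ℝ) ^ (-(κ / (2 * (κ + 2)))) ≤ softProb κ T α r := by
  refine le_min (Real.rpow_le_one_of_one_le_of_nonpos (by exact_mod_cast hT) ?_) (le_max_left _ _)
  rw [neg_nonpos]
  positivity

theorem softProb_pos {κ : ℝ} (hκ : 0 < κ) {T : ℕ} (hT : 1 ≤ T) (α r : ℝ) :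
    0 < softProb κ T α r :=
  (Real.rpow_pos_of_pos (by exact_mod_cast hT) _).trans_le (rpow_neg_le_softProb hκ hT α r)

theorem one_div_softProb_le {κ : ℝ} (hκ : 0 < κ) {T : ℕ} (hT : 1 ≤ T) (α r : ℝ) :
    1 / softProb κ T α r ≤ (T : ℝ) ^ (κ / (2 * (κ + 2))) := by
  have hT0 : (0 : ℝ) < T := by exact_mod_cast hT
  have h := one_div_le_one_div_of_le (Real.rpow_pos_of_pos hT0 _) (rpow_neg_le_softProb hκ hT α r)
  rwa [Real.rpow_neg hT0.le, one_div, one_div, inv_inv, ← one_div] at h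

/-! ### One iteration as a function of what is known before it and of the new data -/

section Step

variable {𝒳 : Type*} {d k : ℕ} {Θ : Set (Fin k → ℝ)}

/-- The heads-up probability at `x`, given the predictor, the comparator, the scale
and the initial threshold. -/
noncomputable def stepProb (N : Seminorm ℝ (Fin d → ℝ)) (h : (Fin k → ℝ) → 𝒳 → Fin d → ℝ)
    (κ : ℝ) (T : ℕ) (q : Θ × Θ × ℝ × ℝ) (x : 𝒳) : ℝ :=
  softProb κ T q.2.2.1 (N (h q.1 x - h q.2.1 x))

/-- The event that `x` is near degeneracy. -/
def stepNear (N : Seminorm ℝ (Fin d → ℝ)) (S : Set (Fin d → ℝ))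
    (h : (Fin k → ℝ) → 𝒳 → Fin d → ℝ) (n₀ t : ℕ) (q : Θ × Θ × ℝ × ℝ) (x : 𝒳) : Prop :=
  nu N S (h q.1 x) < ENNReal.ofReal (threshold q.2.2.2 n₀ t)

open Classical in
/-- The importance weight of the feature vector `x` with the random number `u`. -/
noncomputable def stepWeight (N : Seminorm ℝ (Fin d → ℝ)) (S : Set (Fin d → ℝ))
    (h : (Fin k → ℝ) → 𝒳 → Fin d → ℝ) (κ : ℝ) (T n₀ t : ℕ) (q : Θ × Θ × ℝ × ℝ)
    (x : 𝒳) (u : ℝ) : ℝ :=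
  if stepNear N S h n₀ t q x then 1
  else if u ≤ stepProb N h κ T q x then 1 / stepProb N h κ T q x else 0

theorem stepWeight_mem_Icc (N : Seminorm ℝ (Fin d → ℝ)) (S : Set (Fin d → ℝ))
    (h : (Fin k → ℝ) → 𝒳 → Fin d → ℝ) {κ : ℝ} (hκ : 0 < κ) {T : ℕ} (hT : 1 ≤ T) (n₀ t : ℕ)
    (q : Θ × Θ × ℝ × ℝ) (x : 𝒳) (u : ℝ) :
    stepWeight N S h κ T n₀ t q x u ∈ Set.Icc 0 ((T : ℝ) ^ (κ / (2 * (κ + 2)))) := by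
  have hA : (1 : ℝ) ≤ (T : ℝ) ^ (κ / (2 * (κ + 2))) :=
    Real.one_le_rpow (by exact_mod_cast hT) (by positivity)
  unfold stepWeight
  split_ifs
  · exact ⟨zero_le_one, hA⟩
  · exact ⟨(one_div_pos.2 (softProb_pos hκ hT _ _)).le, one_div_softProb_le hκ hT _ _⟩
  · exact ⟨le_rfl, zero_le_one.trans hA⟩

theorem volume_Icc_inter_Iic {p : ℝ} (hp₁ : p ≤ 1) :
    (volume.restrict (Set.Icc (0 : ℝ) 1)) (Set.Iic p) = ENNReal.ofReal p := by
  rw [Measure.restrict_apply measurableSet_Iic]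
  have : Set.Iic p ∩ Set.Icc 0 1 = Set.Icc 0 p := by
    ext u
    simp only [Set.mem_inter_iff, Set.mem_Iic, Set.mem_Icc]
    constructor
    · rintro ⟨h1, h2, h3⟩; exact ⟨h2, h1⟩
    · rintro ⟨h1, h2⟩; exact ⟨h2, h1, h2.trans hp₁⟩
  rw [this, Real.volume_Icc, sub_zero]

instance isProbabilityMeasure_restrict_Icc :
    IsProbabilityMeasure (volume.restrict (Set.Icc (0 : ℝ) 1)) :=
  ⟨by simp⟩

/-- The coin gives `exp (y / p)` with probability `p` and `1` otherwise. Expanding the exponential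
to second order, the weight leaves the linear term `y` unbiased and costs a factor `1 / p` only in
the quadratic term. -/
theorem lintegral_exp_importance_weight_le {p y : ℝ} (hp₀ : 0 < p) (hp₁ : p ≤ 1)
    (hy : |y / p| ≤ 1) :
    ∫⁻ u in Set.Icc (0 : ℝ) 1, ENNReal.ofReal (Real.exp ((if u ≤ p then 1 / p else 0) * y))
      ≤ ENNReal.ofReal (1 + y + y ^ 2 / p) := by
  have h1 : ∀ u : ℝ, ENNReal.ofReal (Real.exp ((if u ≤ p then 1 / p else 0) * y))
      = (Set.Iic p).indicator (fun _ => ENNReal.ofReal (Real.exp (y / p))) u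
        + (Set.Iic p)ᶜ.indicator (fun _ => 1) u := by
    intro u
    by_cases hu : u ≤ p
    · have : u ∉ (Set.Iic p)ᶜ := by simpa using hu
      rw [if_pos hu, Set.indicator_of_mem (Set.mem_Iic.2 hu), Set.indicator_of_notMem this,
        add_zero, one_div_mul_eq_div]
    · have h2 : u ∈ (Set.Iic p)ᶜ := by simpa using hu
      rw [if_neg hu, Set.indicator_of_notMem (by simpa using hu), Set.indicator_of_mem h2]
      simp
  simp_rw [h1]
  rw [lintegral_add_left (measurable_const.indicator measurableSet_Iic),
    lintegral_indicator_const measurableSet_Iic,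
    lintegral_indicator_const measurableSet_Iic.compl, prob_compl_eq_one_sub measurableSet_Iic,
    volume_Icc_inter_Iic hp₁, ← ENNReal.ofReal_one, ← ENNReal.ofReal_sub _ hp₀.le,
    ← ENNReal.ofReal_mul (Real.exp_nonneg _), ← ENNReal.ofReal_mul zero_le_one,
    ← ENNReal.ofReal_add (by positivity) (by linarith)]
  apply ENNReal.ofReal_le_ofReal
  have h3 := mul_le_mul_of_nonneg_right (exp_le_one_add_add_sq hy) hp₀.le
  have h4 : (1 + y / p + (y / p) ^ 2) * p = p + y + y ^ 2 / p := by field_simp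
  linarith

theorem lintegral_exp_stepWeight_coin_le (N : Seminorm ℝ (Fin d → ℝ)) (S : Set (Fin d → ℝ))
    (h : (Fin k → ℝ) → 𝒳 → Fin d → ℝ) {κ : ℝ} (hκ : 0 < κ) {T : ℕ} (hT : 1 ≤ T) (n₀ t : ℕ)
    (q : Θ × Θ × ℝ × ℝ) (x : 𝒳) {y : ℝ} (hy : (T : ℝ) ^ (κ / (2 * (κ + 2))) * |y| ≤ 1) :
    ∫⁻ u in Set.Icc (0 : ℝ) 1, ENNReal.ofReal (Real.exp (stepWeight N S h κ T n₀ t q x u * y))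
      ≤ ENNReal.ofReal (1 + y + (T : ℝ) ^ (κ / (2 * (κ + 2))) * y ^ 2) := by
  have hA : (1 : ℝ) ≤ (T : ℝ) ^ (κ / (2 * (κ + 2))) :=
    Real.one_le_rpow (by exact_mod_cast hT) (by positivity)
  by_cases hnear : stepNear N S h n₀ t q x
  · simp only [stepWeight, if_pos hnear, one_mul, lintegral_const, measure_univ, mul_one]
    apply ENNReal.ofReal_le_ofReal
    have h1 : |y| ≤ 1 := by nlinarith [abs_nonneg y]
    have h2 := exp_le_one_add_add_sq h1
    nlinarith [sq_nonneg y]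
  · simp only [stepWeight, if_neg hnear]
    have hp := softProb_pos hκ hT q.2.2.1 (N (h q.1 x - h q.2.1 x))
    have hinv := one_div_softProb_le hκ hT q.2.2.1 (N (h q.1 x - h q.2.1 x))
    refine (lintegral_exp_importance_weight_le hp (softProb_le_one _ _ _ _) ?_).trans ?_
    · rw [abs_div, abs_of_pos hp, div_eq_mul_one_div, mul_comm]
      exact (mul_le_mul_of_nonneg_right hinv (abs_nonneg y)).trans hy
    · apply ENNReal.ofReal_le_ofReal
      rw [div_eq_mul_one_div, mul_comm (y ^ 2)]
      have := mul_le_mul_of_nonneg_right hinv (sq_nonneg y)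
      linarith

variable [MeasurableSpace 𝒳]

/-- A Carathéodory function: continuous in the parameter, measurable in the feature. Both are known
on `Θ` only, hence the subtype here and in the states `q`. -/
theorem measurable_predictor {h : (Fin k → ℝ) → 𝒳 → Fin d → ℝ}
    (h_meas : ∀ θ ∈ Θ, Measurable (h θ)) {L₁ : ℝ}
    (hL₁ : ∀ θ₁ ∈ Θ, ∀ θ₂ ∈ Θ, ∀ x, ‖h θ₁ x - h θ₂ x‖ ≤ L₁ * ‖θ₁ - θ₂‖) :
    Measurable fun p : Θ × 𝒳 => h p.1 p.2 := by
  refine measurable_uncurry_of_continuous_of_measurable (u := fun (θ : Θ) x => h θ x) (fun x => ?_)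
    (fun θ => h_meas θ θ.2)
  refine (LipschitzWith.of_dist_le_mul (K := L₁.toNNReal) fun θ₁ θ₂ => ?_).continuous
  rw [dist_eq_norm, Subtype.dist_eq, dist_eq_norm]
  exact (hL₁ θ₁ θ₁.2 θ₂ θ₂.2 x).trans
    (mul_le_mul_of_nonneg_right (Real.le_coe_toNNReal L₁) (norm_nonneg _))

theorem measurable_threshold (n₀ t : ℕ) : Measurable fun b : ℝ => threshold b n₀ t := by
  unfold threshold
  split_ifs <;> fun_prop

variable {h : (Fin k → ℝ) → 𝒳 → Fin d → ℝ}

theorem measurable_stepProb (hh : Measurable fun p : Θ × 𝒳 => h p.1 p.2)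
    (N : Seminorm ℝ (Fin d → ℝ)) (κ : ℝ) (T : ℕ) :
    Measurable fun p : (Θ × Θ × ℝ × ℝ) × 𝒳 => stepProb N h κ T p.1 p.2 := by
  unfold stepProb softProb
  have h1 : Measurable fun p : (Θ × Θ × ℝ × ℝ) × 𝒳 => h p.1.1 p.2 :=
    hh.comp (measurable_fst.fst.prodMk measurable_snd)
  have h2 : Measurable fun p : (Θ × Θ × ℝ × ℝ) × 𝒳 => h p.1.2.1 p.2 :=
    hh.comp (measurable_fst.snd.fst.prodMk measurable_snd)
  have h3 := (continuous_seminorm N).measurable.comp (h1.sub h2)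
  exact measurable_const.min (measurable_const.max (measurable_fst.snd.snd.fst.mul h3))

theorem measurableSet_stepNear (hh : Measurable fun p : Θ × 𝒳 => h p.1 p.2)
    (N : Seminorm ℝ (Fin d → ℝ)) (S : Set (Fin d → ℝ)) (n₀ t : ℕ) :
    MeasurableSet {p : (Θ × Θ × ℝ × ℝ) × 𝒳 | stepNear N S h n₀ t p.1 p.2} := by
  unfold stepNear
  have h1 : Measurable fun p : (Θ × Θ × ℝ × ℝ) × 𝒳 => h p.1.1 p.2 :=
    hh.comp (measurable_fst.fst.prodMk measurable_snd)
  exact measurableSet_lt ((measurable_nu N S).comp h1)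
    (((measurable_threshold n₀ t).comp measurable_fst.snd.snd.snd).ennreal_ofReal)

theorem measurableSet_stepHeads (hh : Measurable fun p : Θ × 𝒳 => h p.1 p.2)
    (N : Seminorm ℝ (Fin d → ℝ)) (κ : ℝ) (T : ℕ) :
    MeasurableSet {p : (Θ × Θ × ℝ × ℝ) × 𝒳 × ℝ | p.2.2 ≤ stepProb N h κ T p.1 p.2.1} :=
  measurableSet_le measurable_snd.snd
    ((measurable_stepProb hh N κ T).comp (measurable_fst.prodMk measurable_snd.fst))

theorem measurable_stepWeight (hh : Measurable fun p : Θ × 𝒳 => h p.1 p.2)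
    (N : Seminorm ℝ (Fin d → ℝ)) (S : Set (Fin d → ℝ)) (κ : ℝ) (T n₀ t : ℕ) :
    Measurable fun p : (Θ × Θ × ℝ × ℝ) × 𝒳 × ℝ =>
      stepWeight N S h κ T n₀ t p.1 p.2.1 p.2.2 := by
  unfold stepWeight
  have hproj : Measurable fun p : (Θ × Θ × ℝ × ℝ) × 𝒳 × ℝ => (p.1, p.2.1) :=
    measurable_fst.prodMk measurable_snd.fst
  refine Measurable.ite ((measurableSet_stepNear hh N S n₀ t).preimage hproj) measurable_const
    (Measurable.ite (measurableSet_stepHeads hh N κ T) ?_ measurable_const)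
  exact measurable_const.div ((measurable_stepProb hh N κ T).comp hproj)

theorem measurable_stepWeight_comp (hh : Measurable fun p : Θ × 𝒳 => h p.1 p.2)
    (N : Seminorm ℝ (Fin d → ℝ)) (S : Set (Fin d → ℝ)) (κ : ℝ) (T n₀ t : ℕ) {β : Type*}
    {mβ : MeasurableSpace β} {q : β → Θ × Θ × ℝ × ℝ} {x : β → 𝒳} {u : β → ℝ}
    (hq : Measurable q) (hx : Measurable x) (hu : Measurable u) :
    Measurable fun b => stepWeight N S h κ T n₀ t (q b) (x b) (u b) := by
  simpa only [Function.comp_def] using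
    (measurable_stepWeight hh N S κ T n₀ t).comp (hq.prodMk (hx.prodMk hu))

/-- One step of the exponential supermartingale. Integrating the coin leaves `1 - r g + r² A g²`;
the Bernstein condition `hgK` and the smallness `hrK` of `r` let the quadratic term consume at most
half of the linear one. The bound does not depend on the state `q`. -/
theorem lintegral_exp_stepWeight_le (hh : Measurable fun p : Θ × 𝒳 => h p.1 p.2)
    (N : Seminorm ℝ (Fin d → ℝ)) (S : Set (Fin d → ℝ))
    {κ : ℝ} (hκ : 0 < κ) {T : ℕ} (hT : 1 ≤ T) (n₀ t : ℕ)
    (q : Θ × Θ × ℝ × ℝ) {D : Measure (𝒳 × (Fin d → ℝ))} [IsProbabilityMeasure D]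
    {g : 𝒳 × (Fin d → ℝ) → ℝ} (hg : Measurable g) {M K r : ℝ} (hgM : ∀ᵐ z ∂D, |g z| ≤ M)
    (hgK : ∀ᵐ z ∂D, g z ^ 2 ≤ K * ∫ z, g z ∂D)
    (hr : 0 ≤ r) (hrM : r * (T : ℝ) ^ (κ / (2 * (κ + 2))) * M ≤ 1)
    (hrK : r * (T : ℝ) ^ (κ / (2 * (κ + 2))) * K ≤ 1 / 2) (hpos : 0 ≤ ∫ z, g z ∂D) :
    ∫⁻ z, ENNReal.ofReal (Real.exp (-r * (stepWeight N S h κ T n₀ t q z.1.1 z.2 * g z.1)))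
        ∂(D.prod (volume.restrict (Set.Icc (0 : ℝ) 1)))
      ≤ ENNReal.ofReal (Real.exp (-(r * (∫ z, g z ∂D) / 2))) := by
  set A := (T : ℝ) ^ (κ / (2 * (κ + 2))) with hAdef
  have hA : (1 : ℝ) ≤ A := Real.one_le_rpow (by exact_mod_cast hT) (by positivity)
  have hint : Integrable g D := Integrable.of_bound hg.aestronglyMeasurable M hgM
  have hint2 : Integrable (fun z => g z ^ 2) D := by
    refine Integrable.of_bound (hg.pow_const 2).aestronglyMeasurable (K * ∫ z, g z ∂D)
      (hgK.mono fun z hz => ?_)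
    rwa [Real.norm_of_nonneg (sq_nonneg _)]
  have hmeas : Measurable fun z : (𝒳 × (Fin d → ℝ)) × ℝ =>
      ENNReal.ofReal (Real.exp (-r * (stepWeight N S h κ T n₀ t q z.1.1 z.2 * g z.1))) := by
    have h1 : Measurable fun z : (𝒳 × (Fin d → ℝ)) × ℝ => stepWeight N S h κ T n₀ t q z.1.1 z.2 :=
      measurable_stepWeight_comp hh N S κ T n₀ t measurable_const measurable_fst.fst measurable_snd
    exact (Real.measurable_exp.comp
      (measurable_const.mul (h1.mul (hg.comp measurable_fst)))).ennreal_ofReal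
  rw [lintegral_prod _ hmeas.aemeasurable]
  have hcoin : ∀ᵐ z ∂D, ∫⁻ u in Set.Icc (0 : ℝ) 1,
      ENNReal.ofReal (Real.exp (-r * (stepWeight N S h κ T n₀ t q z.1 u * g z)))
        ≤ ENNReal.ofReal (1 + -r * g z + r ^ 2 * A * g z ^ 2) := by
    filter_upwards [hgM] with z hz
    have h1 := lintegral_exp_stepWeight_coin_le N S h hκ hT n₀ t q z.1 (y := -r * g z) (by
      rw [abs_mul, abs_neg, abs_of_nonneg hr]
      have : r * A * |g z| ≤ r * A * M := mul_le_mul_of_nonneg_left hz (by positivity)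
      rw [← hAdef]
      nlinarith)
    convert h1 using 3
    · ring_nf
    · rw [← hAdef]; ring
  refine (lintegral_mono_ae hcoin).trans ?_
  have hi1 : Integrable (fun z => 1 + -r * g z) D := (integrable_const 1).add (hint.const_mul _)
  have hi3 : Integrable (fun z => 1 + -r * g z + r ^ 2 * A * g z ^ 2) D :=
    hi1.add (hint2.const_mul _)
  -- Nonnegativity lets the Lebesgue integral of `ENNReal.ofReal` become a real integral; it holds
  -- because `A ≥ 1` and `1 - u + u² ≥ 0`.
  have hnn : 0 ≤ᵐ[D] fun z => 1 + -r * g z + r ^ 2 * A * g z ^ 2 := by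
    refine Eventually.of_forall fun z => ?_
    have : r ^ 2 * g z ^ 2 ≤ r ^ 2 * A * g z ^ 2 := by
      nlinarith [mul_nonneg (sq_nonneg r) (sq_nonneg (g z))]
    change 0 ≤ 1 + -r * g z + r ^ 2 * A * g z ^ 2
    nlinarith [sq_nonneg (r * g z - 1)]
  rw [← ofReal_integral_eq_lintegral_ofReal hi3 hnn]
  apply ENNReal.ofReal_le_ofReal
  rw [integral_add hi1 (hint2.const_mul _),
    integral_add (integrable_const 1) (hint.const_mul _), integral_const_mul, integral_const_mul,
    integral_const, smul_eq_mul, mul_one, probReal_univ]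
  have h2 : ∫ z, g z ^ 2 ∂D ≤ K * ∫ z, g z ∂D := by
    have := integral_mono_ae hint2 (integrable_const _) hgK
    simpa using this
  have h3 : r ^ 2 * A * ∫ z, g z ^ 2 ∂D ≤ r / 2 * ∫ z, g z ∂D := by
    calc r ^ 2 * A * ∫ z, g z ^ 2 ∂D ≤ r ^ 2 * A * (K * ∫ z, g z ∂D) :=
          mul_le_mul_of_nonneg_left h2 (by positivity)
      _ = (r * A * K) * (r * ∫ z, g z ∂D) := by ring
      _ ≤ 1 / 2 * (r * ∫ z, g z ∂D) := mul_le_mul_of_nonneg_right hrK (by positivity)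
      _ = _ := by ring
  have h4 := Real.add_one_le_exp (-(r * (∫ z, g z ∂D) / 2))
  linarith

end Step

/-! ### The exponential moments of the weighted sums -/

namespace Run

variable {Ω : Type*} [MeasurableSpace Ω] {𝒳 : Type*} {d k n₀ : ℕ}

/-- What the choices before iteration `t + 1` amount to. -/
def state (R : Run Ω 𝒳 d k n₀) {Θ : Set (Fin k → ℝ)} (hθ : ∀ t ω, R.θ t ω ∈ Θ)
    (hθstar : ∀ t ω, R.θstar t ω ∈ Θ) (t : ℕ) (ω : Ω) : Θ × Θ × ℝ × ℝ :=
  (⟨R.θ t ω, hθ t ω⟩, ⟨R.θstar t ω, hθstar t ω⟩, R.α t ω, R.b₀ ω)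

namespace IsExecution

variable [MeasurableSpace 𝒳] {R : Run Ω 𝒳 d k n₀} {P : Measure Ω}
  {D : Measure (𝒳 × (Fin d → ℝ))} {N : Seminorm ℝ (Fin d → ℝ)} {S : Set (Fin d → ℝ)}
  {l : (Fin d → ℝ) → (Fin d → ℝ) → ℝ} {Θ : Set (Fin k → ℝ)}
  {h : (Fin k → ℝ) → 𝒳 → Fin d → ℝ} {κ αlo αhi : ℝ} {T : ℕ}

theorem measurable_state (hR : R.IsExecution P D N S l Θ h κ αlo αhi T) (t : ℕ) :
    Measurable[R.hist t] (R.state hR.θ_mem hR.θstar_mem t) :=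
  ((hR.θ_meas t).subtype_mk).prodMk (((hR.θstar_meas t).subtype_mk).prodMk
    ((hR.α_meas t).prodMk (hR.b₀_meas.mono (R.hist.mono (Nat.zero_le t)) le_rfl)))

theorem measurable_data (hR : R.IsExecution P D N S l Θ h κ αlo αhi T) (t : ℕ) :
    Measurable[R.hist (t + 1)] fun ω => (R.sample (t + 1) ω, R.coin (t + 1) ω) :=
  (hR.sample_meas t).prodMk (hR.coin_meas t)

theorem measurable_sample (hR : R.IsExecution P D N S l Θ h κ αlo αhi T) (t : ℕ) :
    Measurable (R.sample (t + 1)) :=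
  (hR.sample_meas t).mono (R.hist.le _) le_rfl

theorem ae_warmup (hR : R.IsExecution P D N S l Θ h κ αlo αhi T) {p : 𝒳 × (Fin d → ℝ) → Prop}
    (hp : ∀ᵐ z ∂D, p z) (i : Fin n₀) : ∀ᵐ ω ∂P, p (R.warmup i ω) := by
  rw [← hR.warmup_law i] at hp
  exact ae_of_ae_map ((hR.warmup_meas i).mono (R.hist.le _) le_rfl).aemeasurable hp

theorem weight_eq (hR : R.IsExecution P D N S l Θ h κ αlo αhi T) (t : ℕ) (ω : Ω) :
    R.weight N S h κ T t ω = stepWeight N S h κ T n₀ t (R.state hR.θ_mem hR.θstar_mem t ω)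
      (R.sample (t + 1) ω).1 (R.coin (t + 1) ω) := rfl

theorem map_sample (hR : R.IsExecution P D N S l Θ h κ αlo αhi T) (t : ℕ) :
    P.map (R.sample (t + 1)) = D := by
  have h1 := congrArg (Measure.map Prod.fst) (hR.law t)
  rw [Measure.map_map measurable_fst ((hR.measurable_data t).mono (R.hist.le _) le_rfl),
    Measure.map_fst_prod, measure_univ, one_smul] at h1
  exact h1

theorem ae_sample (hR : R.IsExecution P D N S l Θ h κ αlo αhi T) {p : 𝒳 × (Fin d → ℝ) → Prop}
    (hp : ∀ᵐ z ∂D, p z) (t : ℕ) : ∀ᵐ ω ∂P, p (R.sample (t + 1) ω) := by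
  rw [← hR.map_sample t] at hp
  exact ae_of_ae_map (hR.measurable_sample t).aemeasurable hp

theorem measurable_weightedSum (hR : R.IsExecution P D N S l Θ h κ αlo αhi T)
    (hh : Measurable fun p : Θ × 𝒳 => h p.1 p.2) {g : 𝒳 × (Fin d → ℝ) → ℝ} (hg : Measurable g)
    (t : ℕ) : Measurable[R.hist t] fun ω =>
      ∑ s ∈ Finset.range t, R.weight N S h κ T s ω * g (R.sample (s + 1) ω) := by
  refine Finset.measurable_fun_sum _ fun s hs => ?_
  have hst : s + 1 ≤ t := Finset.mem_range.1 hs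
  simp only [hR.weight_eq]
  have h2 : Measurable[R.hist t] (R.state hR.θ_mem hR.θstar_mem s) :=
    (hR.measurable_state s).mono (R.hist.mono (by omega)) le_rfl
  have h3 : Measurable[R.hist t] fun ω => (R.sample (s + 1) ω, R.coin (s + 1) ω) :=
    (hR.measurable_data s).mono (R.hist.mono hst) le_rfl
  exact (measurable_stepWeight_comp hh N S κ T n₀ s h2 h3.fst.fst h3.snd).mul (hg.comp h3.fst)

variable [IsProbabilityMeasure P]

/-- The new sample and coin can be integrated out with everything known after iteration `t` held
fixed. -/
theorem lintegral_step (hR : R.IsExecution P D N S l Θ h κ αlo αhi T) (t : ℕ) {β : Type*}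
    [MeasurableSpace β] {Y : Ω → β} (hY : Measurable[R.hist t] Y)
    {f : β × (𝒳 × (Fin d → ℝ)) × ℝ → ℝ≥0∞} (hf : Measurable f) :
    ∫⁻ ω, f (Y ω, (R.sample (t + 1) ω, R.coin (t + 1) ω)) ∂P =
      ∫⁻ ω, ∫⁻ z, f (Y ω, z) ∂(D.prod (volume.restrict (Set.Icc (0 : ℝ) 1))) ∂P := by
  rw [← hR.law t]
  refine lintegral_indepFun (hY.mono (R.hist.le _) le_rfl)
    ((hR.measurable_data t).mono (R.hist.le _) le_rfl) ?_ hf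
  rw [IndepFun_iff_Indep]
  exact indep_of_indep_of_le_left (hR.indep t).symm hY.comap_le

/-- The last iteration is peeled off: the earlier sum is part of what is known, and the last factor
is bounded uniformly over the state, so adaptive choices do no harm. -/
theorem lintegral_exp_weightedSum_le (hR : R.IsExecution P D N S l Θ h κ αlo αhi T)
    [IsProbabilityMeasure D] (hh : Measurable fun p : Θ × 𝒳 => h p.1 p.2) (hκ : 0 < κ)
    (hT : 1 ≤ T) {g : 𝒳 × (Fin d → ℝ) → ℝ} (hg : Measurable g) {M K r : ℝ}
    (hgM : ∀ᵐ z ∂D, |g z| ≤ M) (hgK : ∀ᵐ z ∂D, g z ^ 2 ≤ K * ∫ z, g z ∂D)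
    (hr : 0 ≤ r) (hrM : r * (T : ℝ) ^ (κ / (2 * (κ + 2))) * M ≤ 1)
    (hrK : r * (T : ℝ) ^ (κ / (2 * (κ + 2))) * K ≤ 1 / 2) (hpos : 0 ≤ ∫ z, g z ∂D) (t : ℕ) :
    ∫⁻ ω, ENNReal.ofReal (Real.exp (-r *
        ∑ s ∈ Finset.range t, R.weight N S h κ T s ω * g (R.sample (s + 1) ω))) ∂P
      ≤ ENNReal.ofReal (Real.exp (-(t * (r * (∫ z, g z ∂D) / 2)))) := by
  induction t with
  | zero => simp
  | succ t ih =>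
    have hY := (hR.measurable_state t).prodMk (hR.measurable_weightedSum hh hg t)
    have hf : Measurable fun p : ((Θ × Θ × ℝ × ℝ) × ℝ) × (𝒳 × (Fin d → ℝ)) × ℝ =>
        ENNReal.ofReal (Real.exp (-r * p.1.2)) * ENNReal.ofReal (Real.exp (-r *
          (stepWeight N S h κ T n₀ t p.1.1 p.2.1.1 p.2.2 * g p.2.1))) := by
      have h1 : Measurable fun p : ((Θ × Θ × ℝ × ℝ) × ℝ) × (𝒳 × (Fin d → ℝ)) × ℝ =>
          stepWeight N S h κ T n₀ t p.1.1 p.2.1.1 p.2.2 :=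
        measurable_stepWeight_comp hh N S κ T n₀ t measurable_fst.fst measurable_snd.fst.fst
          measurable_snd.snd
      exact (Real.measurable_exp.comp (measurable_const.mul measurable_fst.snd)).ennreal_ofReal.mul
        (Real.measurable_exp.comp (measurable_const.mul
          (h1.mul (hg.comp measurable_snd.fst)))).ennreal_ofReal
    have key := hR.lintegral_step t hY hf
    have hsplit : ∀ ω, ENNReal.ofReal (Real.exp (-r *
        ∑ s ∈ Finset.range (t + 1), R.weight N S h κ T s ω * g (R.sample (s + 1) ω)))
        = ENNReal.ofReal (Real.exp (-r *
          ∑ s ∈ Finset.range t, R.weight N S h κ T s ω * g (R.sample (s + 1) ω))) *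
          ENNReal.ofReal (Real.exp (-r * (stepWeight N S h κ T n₀ t
            (R.state hR.θ_mem hR.θstar_mem t ω) (R.sample (t + 1) ω).1 (R.coin (t + 1) ω)
            * g (R.sample (t + 1) ω)))) := by
      intro ω
      rw [Finset.sum_range_succ, mul_add, Real.exp_add, ENNReal.ofReal_mul (Real.exp_nonneg _)]
      rfl
    rw [lintegral_congr hsplit]
    refine key.trans_le ?_
    have hinner : ∀ ω, ∫⁻ z, ENNReal.ofReal (Real.exp (-r *
          ∑ s ∈ Finset.range t, R.weight N S h κ T s ω * g (R.sample (s + 1) ω))) *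
          ENNReal.ofReal (Real.exp (-r * (stepWeight N S h κ T n₀ t
            (R.state hR.θ_mem hR.θstar_mem t ω) z.1.1 z.2 * g z.1)))
          ∂(D.prod (volume.restrict (Set.Icc (0 : ℝ) 1)))
        ≤ ENNReal.ofReal (Real.exp (-r *
          ∑ s ∈ Finset.range t, R.weight N S h κ T s ω * g (R.sample (s + 1) ω))) *
          ENNReal.ofReal (Real.exp (-(r * (∫ z, g z ∂D) / 2))) := by
      intro ω
      rw [lintegral_const_mul' _ _ ENNReal.ofReal_ne_top]
      gcongr
      exact lintegral_exp_stepWeight_le hh N S hκ hT n₀ t _ hg hgM hgK hr hrM hrK hpos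
    refine (lintegral_mono hinner).trans ?_
    rw [lintegral_mul_const' _ _ ENNReal.ofReal_ne_top]
    refine (mul_le_mul_left ih _).trans (le_of_eq ?_)
    rw [← ENNReal.ofReal_mul (Real.exp_nonneg _), ← Real.exp_add]
    congr 2
    push_cast
    ring

theorem measure_weightedSum_le (hR : R.IsExecution P D N S l Θ h κ αlo αhi T)
    [IsProbabilityMeasure D] (hh : Measurable fun p : Θ × 𝒳 => h p.1 p.2) (hκ : 0 < κ)
    (hT : 1 ≤ T) {g : 𝒳 × (Fin d → ℝ) → ℝ} (hg : Measurable g) {M K r : ℝ}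
    (hgM : ∀ᵐ z ∂D, |g z| ≤ M) (hgK : ∀ᵐ z ∂D, g z ^ 2 ≤ K * ∫ z, g z ∂D)
    (hr : 0 ≤ r) (hrM : r * (T : ℝ) ^ (κ / (2 * (κ + 2))) * M ≤ 1)
    (hrK : r * (T : ℝ) ^ (κ / (2 * (κ + 2))) * K ≤ 1 / 2) (hpos : 0 ≤ ∫ z, g z ∂D) (t : ℕ)
    (a : ℝ) :
    P {ω | ∑ s ∈ Finset.range t, R.weight N S h κ T s ω * g (R.sample (s + 1) ω) ≤ a}
      ≤ ENNReal.ofReal (Real.exp (r * a - t * (r * (∫ z, g z ∂D) / 2))) := by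
  have hmeas : Measurable fun ω => ENNReal.ofReal (Real.exp (-r *
      ∑ s ∈ Finset.range t, R.weight N S h κ T s ω * g (R.sample (s + 1) ω))) :=
    (Real.measurable_exp.comp (measurable_const.mul
      ((hR.measurable_weightedSum hh hg t).mono (R.hist.le _) le_rfl))).ennreal_ofReal
  have hsub : {ω | ∑ s ∈ Finset.range t, R.weight N S h κ T s ω * g (R.sample (s + 1) ω) ≤ a} ⊆
      {ω | ENNReal.ofReal (Real.exp (-r * a)) ≤ ENNReal.ofReal (Real.exp (-r *
        ∑ s ∈ Finset.range t, R.weight N S h κ T s ω * g (R.sample (s + 1) ω)))} := by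
    intro ω hω
    refine ENNReal.ofReal_le_ofReal (Real.exp_le_exp.2 ?_)
    exact mul_le_mul_of_nonpos_left hω (by linarith)
  refine (measure_mono hsub).trans ((meas_ge_le_lintegral_div hmeas.aemeasurable
    (by simpa using Real.exp_pos _) ENNReal.ofReal_ne_top).trans ?_)
  refine (ENNReal.div_le_div_right
    (hR.lintegral_exp_weightedSum_le hh hκ hT hg hgM hgK hr hrM hrK hpos t) _).trans ?_
  rw [← ENNReal.ofReal_div_of_pos (Real.exp_pos _), ← Real.exp_sub]
  refine le_of_eq ?_
  congr 2
  ring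

end IsExecution

end Run

/-! ### The risk and the error bound -/

section Risk

variable {𝒳 : Type*} {d k : ℕ} {l : (Fin d → ℝ) → (Fin d → ℝ) → ℝ}
  {𝒞 : Set (Fin d → ℝ)} {Θ : Set (Fin k → ℝ)} {h : (Fin k → ℝ) → 𝒳 → Fin d → ℝ}

theorem abs_loss_sub_le {L₁ L₂ : ℝ}
    (hL₁ : ∀ θ₁ ∈ Θ, ∀ θ₂ ∈ Θ, ∀ x, ‖h θ₁ x - h θ₂ x‖ ≤ L₁ * ‖θ₁ - θ₂‖)
    (hL₂ : ∀ θ₁ ∈ Θ, ∀ θ₂ ∈ Θ, ∀ x₁ x₂, ∀ c ∈ 𝒞,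
      |l (h θ₁ x₁) c - l (h θ₂ x₂) c| ≤ L₂ * ‖h θ₁ x₁ - h θ₂ x₂‖)
    {θ₁ θ₂ : Fin k → ℝ} (h₁ : θ₁ ∈ Θ) (h₂ : θ₂ ∈ Θ) (x : 𝒳) {c : Fin d → ℝ} (hc : c ∈ 𝒞) :
    |l (h θ₁ x) c - l (h θ₂ x) c| ≤ |L₁| * |L₂| * ‖θ₁ - θ₂‖ := by
  calc |l (h θ₁ x) c - l (h θ₂ x) c| ≤ L₂ * ‖h θ₁ x - h θ₂ x‖ := hL₂ θ₁ h₁ θ₂ h₂ x x c hc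
    _ ≤ |L₂| * ‖h θ₁ x - h θ₂ x‖ := mul_le_mul_of_nonneg_right (le_abs_self _) (norm_nonneg _)
    _ ≤ |L₂| * (|L₁| * ‖θ₁ - θ₂‖) := by
      refine mul_le_mul_of_nonneg_left ((hL₁ θ₁ h₁ θ₂ h₂ x).trans ?_) (abs_nonneg _)
      exact mul_le_mul_of_nonneg_right (le_abs_self _) (norm_nonneg _)
    _ = _ := by ring

theorem exists_seminorm_predictor_sub_le (N : Seminorm ℝ (Fin d → ℝ))
    (hΘ : Bornology.IsBounded Θ) {L₁ : ℝ}
    (hL₁ : ∀ θ₁ ∈ Θ, ∀ θ₂ ∈ Θ, ∀ x, ‖h θ₁ x - h θ₂ x‖ ≤ L₁ * ‖θ₁ - θ₂‖) :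
    ∃ b : ℝ, 0 ≤ b ∧ ∀ θ₁ ∈ Θ, ∀ θ₂ ∈ Θ, ∀ x, N (h θ₁ x - h θ₂ x) ≤ b := by
  obtain ⟨K, hK, hN⟩ := exists_seminorm_le N
  obtain ⟨r, hr⟩ := hΘ.exists_norm_le
  refine ⟨K * (|L₁| * (2 * |r|)), by positivity, fun θ₁ h₁ θ₂ h₂ x => (hN _).trans ?_⟩
  gcongr
  refine (hL₁ θ₁ h₁ θ₂ h₂ x).trans ?_
  gcongr
  · exact le_abs_self _
  · have := norm_sub_le θ₁ θ₂
    have := hr θ₁ h₁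
    have := hr θ₂ h₂
    have := le_abs_self r
    linarith

variable [MeasurableSpace 𝒳] {N : Seminorm ℝ (Fin d → ℝ)} {D : Measure (𝒳 × (Fin d → ℝ))}

theorem optRisk_eq {H : Set (𝒳 → Fin d → ℝ)} {f : 𝒳 → Fin d → ℝ} (hf : f ∈ optSet D l H) :
    optRisk D l H = risk D l f :=
  IsLeast.csInf_eq ⟨⟨f, hf.1, rfl⟩, by rintro _ ⟨f', hf', rfl⟩; exact hf.2 f' hf'⟩

theorem measurable_loss (h_meas : ∀ θ ∈ Θ, Measurable (h θ))
    (l_meas : Measurable (Function.uncurry l)) {θ : Fin k → ℝ} (hθ : θ ∈ Θ) :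
    Measurable fun z : 𝒳 × (Fin d → ℝ) => l (h θ z.1) z.2 :=
  l_meas.comp (((h_meas θ hθ).comp measurable_fst).prodMk measurable_snd)

theorem integrable_loss [IsProbabilityMeasure D] (hD𝒞 : ∀ᵐ z ∂D, z.2 ∈ 𝒞)
    (h_meas : ∀ θ ∈ Θ, Measurable (h θ))
    (l_meas : Measurable (Function.uncurry l)) (l_nonneg : ∀ chat c, 0 ≤ l chat c)
    {M : ℝ} (hM : ∀ θ ∈ Θ, ∀ x, ∀ c ∈ 𝒞, l (h θ x) c ≤ M) {θ : Fin k → ℝ} (hθ : θ ∈ Θ) :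
    Integrable (fun z : 𝒳 × (Fin d → ℝ) => l (h θ z.1) z.2) D := by
  refine Integrable.of_bound (measurable_loss h_meas l_meas hθ).aestronglyMeasurable M ?_
  filter_upwards [hD𝒞] with z hz
  rw [Real.norm_of_nonneg (l_nonneg _ _)]
  exact hM θ hθ _ _ hz

theorem risk_le_risk_add [IsProbabilityMeasure D] (hD𝒞 : ∀ᵐ z ∂D, z.2 ∈ 𝒞)
    (h_meas : ∀ θ ∈ Θ, Measurable (h θ)) {L₁ L₂ : ℝ}
    (hL₁ : ∀ θ₁ ∈ Θ, ∀ θ₂ ∈ Θ, ∀ x, ‖h θ₁ x - h θ₂ x‖ ≤ L₁ * ‖θ₁ - θ₂‖)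
    (l_meas : Measurable (Function.uncurry l)) (l_nonneg : ∀ chat c, 0 ≤ l chat c)
    {M : ℝ} (hM : ∀ θ ∈ Θ, ∀ x, ∀ c ∈ 𝒞, l (h θ x) c ≤ M)
    (hL₂ : ∀ θ₁ ∈ Θ, ∀ θ₂ ∈ Θ, ∀ x₁ x₂, ∀ c ∈ 𝒞,
      |l (h θ₁ x₁) c - l (h θ₂ x₂) c| ≤ L₂ * ‖h θ₁ x₁ - h θ₂ x₂‖)
    {θ θ' : Fin k → ℝ} (hθ : θ ∈ Θ) (hθ' : θ' ∈ Θ) :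
    risk D l (h θ) ≤ risk D l (h θ') + |L₁| * |L₂| * ‖θ - θ'‖ := by
  have hi := integrable_loss hD𝒞 h_meas l_meas l_nonneg hM hθ'
  have h1 : risk D l (h θ) ≤ ∫ z, (l (h θ' z.1) z.2 + |L₁| * |L₂| * ‖θ - θ'‖) ∂D := by
    refine integral_mono_ae (integrable_loss hD𝒞 h_meas l_meas l_nonneg hM hθ)
      (hi.add (integrable_const _)) ?_
    filter_upwards [hD𝒞] with z hz
    have h2 := (le_abs_self _).trans (abs_loss_sub_le hL₁ hL₂ hθ hθ' z.1 hz)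
    linarith
  rw [integral_add hi (integrable_const _)] at h1
  simp only [integral_const, probReal_univ, one_smul] at h1
  exact h1

/-- The asymptotic bound on `φ` covers small `ε`; for `ε ≥ ε₀` the diameter bound `b` is at most `b
/ √ε₀ * √ε`. The summand `1` in the constant makes the inequality strict, so that a minimizer this
close can be picked without attaining the infimum. -/
theorem exists_essDist_lt {wstar : (Fin d → ℝ) → Fin d → ℝ} {φ : ℝ → ℝ}
    (hφ : ConsistencyErrorBound N D wstar l (h '' Θ) φ) {b : ℝ} (hb : 0 ≤ b)
    (hhb : ∀ θ₁ ∈ Θ, ∀ θ₂ ∈ Θ, ∀ x, N (h θ₁ x - h θ₂ x) ≤ b) :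
    ∃ K : ℝ, 0 < K ∧ ∀ θ ∈ Θ, ∀ ε : ℝ, 0 < ε →
      risk D l (h θ) - optRisk D l (h '' Θ) ≤ ε →
      essDist N (D.map Prod.fst) (optSet D l (h '' Θ)) (h θ) < K * √ε := by
  obtain ⟨c, hc, hbound⟩ := hφ.phi_sqrt.exists_pos
  obtain ⟨ε₀, hε₀, hsub⟩ := mem_nhdsGT_iff_exists_Ioo_subset.1 hbound.bound
  have hε₀ : 0 < ε₀ := hε₀
  have hs₀ : 0 < √ε₀ := Real.sqrt_pos.2 hε₀
  refine ⟨c + b / √ε₀ + 1, by positivity, fun θ hθ ε hε hrisk => ?_⟩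
  have hs : 0 < √ε := Real.sqrt_pos.2 hε
  have hbs : 0 ≤ b / √ε₀ := by positivity
  rcases lt_or_ge ε ε₀ with hlt | hge
  · have h1 : ‖φ ε‖ ≤ c * ‖√ε‖ := hsub ⟨hε, hlt⟩
    rw [Real.norm_of_nonneg hs.le] at h1
    have h2 := hφ.error_bound (h θ) ⟨θ, hθ, rfl⟩ ε hε hrisk
    have h3 := (le_abs_self _).trans h1
    nlinarith
  · obtain ⟨f, hf⟩ := hφ.exists_opt
    obtain ⟨θ', hθ', rfl⟩ := hf.1
    have h1 : essDist N (D.map Prod.fst) (optSet D l (h '' Θ)) (h θ) ≤ b := by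
      refine le_trans ?_ (essNorm_le (μ := D.map Prod.fst) hb (hhb θ hθ θ' hθ'))
      refine csInf_le ⟨0, ?_⟩ ⟨h θ', hf, rfl⟩
      rintro _ ⟨f', -, rfl⟩
      exact essNorm_nonneg _ _ _
    have h2 : b ≤ b / √ε₀ * √ε := by
      rw [div_mul_eq_mul_div, le_div_iff₀ hs₀]
      exact mul_le_mul_of_nonneg_left (Real.sqrt_le_sqrt hge) hb
    nlinarith

/-- The Bernstein condition, in pointwise form: a surrogate minimizer within order `√ε` of `h θ`,
with `ε` the excess risk itself, has loss within order `√ε` as well. The comparator depends on `θ`,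
because the minimizer need not be unique. -/
theorem exists_comparator [IsProbabilityMeasure D] (hN : ∀ v, N v = 0 → v = 0)
    {wstar : (Fin d → ℝ) → Fin d → ℝ} {φ : ℝ → ℝ}
    (hφ : ConsistencyErrorBound N D wstar l (h '' Θ) φ) (hΘ : Bornology.IsBounded Θ)
    (hD𝒞 : ∀ᵐ z ∂D, z.2 ∈ 𝒞) {L₁ L₂ : ℝ}
    (hL₁ : ∀ θ₁ ∈ Θ, ∀ θ₂ ∈ Θ, ∀ x, ‖h θ₁ x - h θ₂ x‖ ≤ L₁ * ‖θ₁ - θ₂‖)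
    (hL₂ : ∀ θ₁ ∈ Θ, ∀ θ₂ ∈ Θ, ∀ x₁ x₂, ∀ c ∈ 𝒞,
      |l (h θ₁ x₁) c - l (h θ₂ x₂) c| ≤ L₂ * ‖h θ₁ x₁ - h θ₂ x₂‖) :
    ∃ K : ℝ, 0 ≤ K ∧ ∀ θ ∈ Θ, 0 < risk D l (h θ) - optRisk D l (h '' Θ) →
      ∃ θ' ∈ Θ, h θ' ∈ optSet D l (h '' Θ) ∧ ∀ᵐ z ∂D, (l (h θ z.1) z.2 - l (h θ' z.1) z.2) ^ 2
        ≤ K * (risk D l (h θ) - optRisk D l (h '' Θ)) := by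
  obtain ⟨b, hb, hhb⟩ := exists_seminorm_predictor_sub_le N hΘ hL₁
  obtain ⟨K, hK, hdist⟩ := exists_essDist_lt hφ hb hhb
  obtain ⟨Kn, hKn, hnorm⟩ := exists_norm_le_seminorm N hN
  refine ⟨(|L₂| * (Kn * K)) ^ 2, by positivity, fun θ hθ hpos => ?_⟩
  obtain ⟨_, ⟨_, hopt, rfl⟩, hlt⟩ :=
    exists_lt_of_csInf_lt (hφ.exists_opt.image _) (hdist θ hθ _ hpos le_rfl)
  obtain ⟨θ', hθ', rfl⟩ := hopt.1
  refine ⟨θ', hθ', hopt, ?_⟩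
  have hae := ae_of_ae_map measurable_fst.aemeasurable
    (ae_le_of_essNorm_lt (hhb θ hθ θ' hθ') hlt)
  filter_upwards [hae, hD𝒞] with z hz hc
  have h1 : |l (h θ z.1) z.2 - l (h θ' z.1) z.2| ≤
      |L₂| * (Kn * K) * √(risk D l (h θ) - optRisk D l (h '' Θ)) := by
    calc |l (h θ z.1) z.2 - l (h θ' z.1) z.2| ≤ L₂ * ‖h θ z.1 - h θ' z.1‖ :=
          hL₂ θ hθ θ' hθ' _ _ _ hc
      _ ≤ |L₂| * ‖h θ z.1 - h θ' z.1‖ :=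
        mul_le_mul_of_nonneg_right (le_abs_self _) (norm_nonneg _)
      _ ≤ |L₂| * (Kn * N (h θ z.1 - h θ' z.1)) :=
        mul_le_mul_of_nonneg_left (hnorm _) (abs_nonneg _)
      _ ≤ |L₂| * (Kn * (K * √(risk D l (h θ) - optRisk D l (h '' Θ)))) := by gcongr
      _ = _ := by ring
  rw [← sq_abs]
  refine (pow_le_pow_left₀ (abs_nonneg _) h1 2).trans (le_of_eq ?_)
  rw [mul_pow, Real.sq_sqrt hpos.le]

end Risk

/-! ### The fast rate -/

namespace Run.IsExecution

variable {Ω : Type*} [MeasurableSpace Ω] {𝒳 : Type*} {d k n₀ : ℕ}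
  [MeasurableSpace 𝒳] {R : Run Ω 𝒳 d k n₀} {P : Measure Ω}
  {D : Measure (𝒳 × (Fin d → ℝ))} {N : Seminorm ℝ (Fin d → ℝ)} {S : Set (Fin d → ℝ)}
  {l : (Fin d → ℝ) → (Fin d → ℝ) → ℝ} {𝒞 : Set (Fin d → ℝ)} {Θ : Set (Fin k → ℝ)}
  {h : (Fin k → ℝ) → 𝒳 → Fin d → ℝ} {κ αlo αhi : ℝ} {T : ℕ}

/-- What optimality of `h_t` says about a nearby net point `θ`: the warm-up losses of `θ'` cost at
most `n₀ * M`, and replacing `h_t` by `h θ` costs at most the maximal weight times the Lipschitz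
error in each of the `t` terms. -/
theorem weightedSum_le_of_argmin (hR : R.IsExecution P D N S l Θ h κ αlo αhi T)
    (hn₀ : 1 ≤ n₀) (hκ : 0 < κ) (hT : 1 ≤ T)
    (l_nonneg : ∀ chat c, 0 ≤ l chat c)
    {M L₁ L₂ : ℝ} (hM : ∀ θ ∈ Θ, ∀ x, ∀ c ∈ 𝒞, l (h θ x) c ≤ M)
    (hL₁ : ∀ θ₁ ∈ Θ, ∀ θ₂ ∈ Θ, ∀ x, ‖h θ₁ x - h θ₂ x‖ ≤ L₁ * ‖θ₁ - θ₂‖)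
    (hL₂ : ∀ θ₁ ∈ Θ, ∀ θ₂ ∈ Θ, ∀ x₁ x₂, ∀ c ∈ 𝒞,
      |l (h θ₁ x₁) c - l (h θ₂ x₂) c| ≤ L₂ * ‖h θ₁ x₁ - h θ₂ x₂‖)
    {t : ℕ} {ω : Ω} (hargmin : ∀ θ' ∈ Θ,
      R.empRisk N S l h κ T t ω (R.θ t ω) ≤ R.empRisk N S l h κ T t ω θ')
    (hwarm : ∀ i, (R.warmup i ω).2 ∈ 𝒞) (hsample : ∀ s, (R.sample (s + 1) ω).2 ∈ 𝒞)
    {θ θ' : Fin k → ℝ} (hθ : θ ∈ Θ) (hθ' : θ' ∈ Θ) {η : ℝ} (hη : ‖R.θ t ω - θ‖ ≤ η) :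
    ∑ s ∈ Finset.range t, R.weight N S h κ T s ω *
        (l (h θ (R.sample (s + 1) ω).1) (R.sample (s + 1) ω).2 -
          l (h θ' (R.sample (s + 1) ω).1) (R.sample (s + 1) ω).2)
      ≤ n₀ * M + t * ((T : ℝ) ^ (κ / (2 * (κ + 2))) * (|L₁| * |L₂| * η)) := by
  have h1 := hargmin θ' hθ'
  unfold empRisk at h1
  have hn : (0 : ℝ) < 1 / ((t : ℝ) + n₀) := by
    have : (1 : ℝ) ≤ n₀ := by exact_mod_cast hn₀
    positivity
  replace h1 := le_of_mul_le_mul_left h1 hn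
  have h2 : 0 ≤ ∑ i, l (h (R.θ t ω) (R.warmup i ω).1) (R.warmup i ω).2 :=
    Finset.sum_nonneg fun i _ => l_nonneg _ _
  have h3 : ∑ i, l (h θ' (R.warmup i ω).1) (R.warmup i ω).2 ≤ n₀ * M := by
    refine (Finset.sum_le_card_nsmul _ _ M fun i _ => hM θ' hθ' _ _ (hwarm i)).trans ?_
    simp
  have h4 : ∑ s ∈ Finset.range t, R.weight N S h κ T s ω *
        (l (h θ (R.sample (s + 1) ω).1) (R.sample (s + 1) ω).2 -
          l (h (R.θ t ω) (R.sample (s + 1) ω).1) (R.sample (s + 1) ω).2)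
      ≤ t * ((T : ℝ) ^ (κ / (2 * (κ + 2))) * (|L₁| * |L₂| * η)) := by
    refine (Finset.sum_le_card_nsmul _ _
      ((T : ℝ) ^ (κ / (2 * (κ + 2))) * (|L₁| * |L₂| * η)) fun s _ => ?_).trans ?_
    · have hw := stepWeight_mem_Icc N S h hκ hT n₀ s (R.state hR.θ_mem hR.θstar_mem s ω)
        (R.sample (s + 1) ω).1 (R.coin (s + 1) ω)
      rw [← hR.weight_eq] at hw
      have h5 := abs_loss_sub_le hL₁ hL₂ hθ (hR.θ_mem t ω) (R.sample (s + 1) ω).1 (hsample s)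
      rw [norm_sub_rev] at h5
      have h6 : |L₁| * |L₂| * ‖R.θ t ω - θ‖ ≤ |L₁| * |L₂| * η := by gcongr
      have h7 := (le_abs_self _).trans (h5.trans h6)
      exact (mul_le_mul_of_nonneg_left h7 hw.1).trans
        (mul_le_mul_of_nonneg_right hw.2 ((abs_nonneg _).trans (h5.trans h6)))
    · simp
  have h5 : ∀ s, R.weight N S h κ T s ω *
        (l (h θ (R.sample (s + 1) ω).1) (R.sample (s + 1) ω).2 -
          l (h θ' (R.sample (s + 1) ω).1) (R.sample (s + 1) ω).2) =
      R.weight N S h κ T s ω *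
        (l (h θ (R.sample (s + 1) ω).1) (R.sample (s + 1) ω).2 -
          l (h (R.θ t ω) (R.sample (s + 1) ω).1) (R.sample (s + 1) ω).2) +
      (R.weight N S h κ T s ω * l (h (R.θ t ω) (R.sample (s + 1) ω).1) (R.sample (s + 1) ω).2 -
        R.weight N S h κ T s ω * l (h θ' (R.sample (s + 1) ω).1) (R.sample (s + 1) ω).2) :=
    fun s => by ring
  simp only [h5, Finset.sum_add_distrib, Finset.sum_sub_distrib] at h4 ⊢
  linarith

end Run.IsExecution

theorem exists_fast_rate
    {𝒳 : Type*} [MeasurableSpace 𝒳] {d k n₀ : ℕ} (hn₀ : 1 ≤ n₀)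
    {N : Seminorm ℝ (Fin d → ℝ)} (hN : ∀ v, N v = 0 → v = 0) {S : Set (Fin d → ℝ)}
    {wstar : (Fin d → ℝ) → Fin d → ℝ}
    {D : Measure (𝒳 × (Fin d → ℝ))} [IsProbabilityMeasure D]
    {𝒞 : Set (Fin d → ℝ)} (hD𝒞 : ∀ᵐ z ∂D, z.2 ∈ 𝒞)
    {Θ : Set (Fin k → ℝ)} (hΘ : Bornology.IsBounded Θ)
    {h : (Fin k → ℝ) → 𝒳 → Fin d → ℝ} (h_meas : ∀ θ ∈ Θ, Measurable (h θ))
    {L₁ : ℝ} (hL₁ : ∀ θ₁ ∈ Θ, ∀ θ₂ ∈ Θ, ∀ x, ‖h θ₁ x - h θ₂ x‖ ≤ L₁ * ‖θ₁ - θ₂‖)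
    {l : (Fin d → ℝ) → (Fin d → ℝ) → ℝ} (l_meas : Measurable (Function.uncurry l))
    (l_nonneg : ∀ chat c, 0 ≤ l chat c)
    {M : ℝ} (hM : ∀ θ ∈ Θ, ∀ x, ∀ c ∈ 𝒞, l (h θ x) c ≤ M)
    {L₂ : ℝ} (hL₂ : ∀ θ₁ ∈ Θ, ∀ θ₂ ∈ Θ, ∀ x₁ x₂, ∀ c ∈ 𝒞,
      |l (h θ₁ x₁) c - l (h θ₂ x₂) c| ≤ L₂ * ‖h θ₁ x₁ - h θ₂ x₂‖)
    {φ : ℝ → ℝ} (hφ : ConsistencyErrorBound N D wstar l (h '' Θ) φ)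
    {κ : ℝ} (hκ : 0 < κ) {αlo αhi : ℝ} :
    ∃ C : ℝ, 0 < C ∧ ∀ (T : ℕ), 1 ≤ T → ∀ (δ : ℝ), 0 < δ → δ ≤ 1 →
      ∀ (Ω : Type*) [MeasurableSpace Ω] (P : Measure Ω) [IsProbabilityMeasure P]
        (R : Run Ω 𝒳 d k n₀), R.IsExecution P D N S l Θ h κ αlo αhi T →
        ∀ t : ℕ, 1 ≤ t → t ≤ T →
          P {ω | C * (1 + Real.log (T / δ)) * (T : ℝ) ^ (κ / (2 * (κ + 2))) / t <
            risk D l (h (R.θ t ω)) - optRisk D l (h '' Θ)} ≤ ENNReal.ofReal δ := by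
  classical
  obtain ⟨K, hK, hcomp⟩ := exists_comparator hN hφ hΘ hD𝒞 hL₁ hL₂
  choose! comp hcompΘ hcompopt hcompK using hcomp
  obtain ⟨Kn, hKn, hnet⟩ := exists_finite_net hΘ
  have hh := measurable_predictor h_meas hL₁
  set L : ℝ := |L₁| * |L₂| with hLdef
  have hL : 0 ≤ L := by positivity
  -- Chosen so that `r = c₀ / A` meets both smallness conditions of the exponential moment bound.
  set c₀ : ℝ := 1 / (|M| + 2 * K + 1) with hc₀def
  have hc₀ : 0 < c₀ := by positivity
  have hc₀1 : c₀ ≤ 1 := by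
    rw [hc₀def, div_le_one (by positivity)]
    linarith [abs_nonneg M]
  -- Bounds the weighted sum at the net point next to `h_t`: warm-up, plus a discretization error of
  -- at most `L`.
  set a₀ : ℝ := n₀ * |M| + L with ha₀def
  have ha₀ : 0 ≤ a₀ := by positivity
  have hlogKn : 0 ≤ Real.log Kn := Real.log_nonneg hKn
  set c₁ : ℝ := a₀ + k * Real.log Kn + 2 * k + 1 with hc₁def
  have hc₁ : 0 < c₁ := by positivity
  refine ⟨2 * c₁ / c₀ + L, by positivity, fun T hT δ hδ hδ1 Ω _ P _ R hR t ht htT => ?_⟩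
  have hT0 : (0 : ℝ) < T := by exact_mod_cast hT
  have hT1 : (1 : ℝ) ≤ T := by exact_mod_cast hT
  have ht0 : (0 : ℝ) < t := by exact_mod_cast ht
  have htT' : (t : ℝ) ≤ T := by exact_mod_cast htT
  set A : ℝ := (T : ℝ) ^ (κ / (2 * (κ + 2))) with hAdef
  have hA1 : 1 ≤ A := Real.one_le_rpow hT1 (by positivity)
  have hAT : A ≤ T := by
    have : κ / (2 * (κ + 2)) ≤ 1 := by
      rw [div_le_one (by positivity)]
      linarith
    simpa using Real.rpow_le_rpow_of_exponent_le hT1 this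
  have hlog : Real.log (T / δ) = Real.log T + Real.log (1 / δ) := by
    rw [← Real.log_mul (by positivity) (by positivity)]
    congr 1
    ring
  have hlogT : 0 ≤ Real.log T := Real.log_nonneg hT1
  have hlogδ : 0 ≤ Real.log (1 / δ) := Real.log_nonneg (by rwa [le_div_iff₀ hδ, one_mul])
  set Λ : ℝ := 1 + Real.log (T / δ) with hΛdef
  have hΛ1 : 1 ≤ Λ := by linarith
  set r : ℝ := c₀ / A with hrdef
  have hr : 0 < r := by positivity
  have hrA : r * A = c₀ := by rw [hrdef]; field_simp
  have hrM : r * A * |M| ≤ 1 := by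
    rw [hrA, hc₀def, one_div_mul_eq_div, div_le_one (by positivity)]
    linarith
  have hrK : r * A * K ≤ 1 / 2 := by
    rw [hrA, hc₀def, one_div_mul_eq_div, div_le_iff₀ (by positivity)]
    linarith [abs_nonneg M]
  -- With this mesh `t * A * mesh ≤ 1`, as `t` and `A` are at most `T`, while the logarithm of the
  -- size of the net stays of order `1 + log T`.
  obtain ⟨F, hFΘ, hFcard, hFnet⟩ := hnet (1 / (T : ℝ) ^ 2) (by positivity)
    (by rw [div_le_one (by positivity)]; nlinarith)
  set ex : (Fin k → ℝ) → ℝ := fun θ => risk D l (h θ) - optRisk D l (h '' Θ) with hexdef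
  set thr : ℝ := 2 * c₁ / c₀ * Λ * A / t with hthrdef
  have hthr : 0 < thr := by positivity
  set g : (Fin k → ℝ) → 𝒳 × (Fin d → ℝ) → ℝ :=
    fun θ z => l (h θ z.1) z.2 - l (h (comp θ) z.1) z.2 with hgdef
  set E : (Fin k → ℝ) → Set Ω := fun θ =>
    {ω | ∑ s ∈ Finset.range t, R.weight N S h κ T s ω * g θ (R.sample (s + 1) ω) ≤ a₀} with hEdef
  set Bd : ℝ := (Kn / (1 / (T : ℝ) ^ 2)) ^ k with hBddef
  have hBd : 0 < Bd := by positivity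
  have hlogBd : Real.log Bd = k * Real.log Kn + 2 * k * Real.log T := by
    rw [hBddef, Real.log_pow, div_div_eq_mul_div, div_one,
      Real.log_mul (by positivity) (by positivity), Real.log_pow]
    push_cast
    ring
  have hE : ∀ θ ∈ F, thr < ex θ → P (E θ) ≤ ENNReal.ofReal (δ / Bd) := by
    intro θ hθF hθ
    have hθΘ := hFΘ θ hθF
    have hpos : 0 < ex θ := hthr.trans hθ
    have hcΘ := hcompΘ θ hθΘ hpos
    have hg : Measurable (g θ) :=
      (measurable_loss h_meas l_meas hθΘ).sub (measurable_loss h_meas l_meas hcΘ)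
    have hint : ∫ z, g θ z ∂D = ex θ := by
      have := integral_sub (integrable_loss hD𝒞 h_meas l_meas l_nonneg hM hθΘ)
        (integrable_loss hD𝒞 h_meas l_meas l_nonneg hM hcΘ)
      rw [hgdef, hexdef]
      simp only
      rw [this, optRisk_eq (hcompopt θ hθΘ hpos)]
      rfl
    have hgM : ∀ᵐ z ∂D, |g θ z| ≤ |M| := by
      filter_upwards [hD𝒞] with z hz
      have h1 := hM θ hθΘ z.1 z.2 hz
      have h2 := hM (comp θ) hcΘ z.1 z.2 hz
      have h3 := l_nonneg (h θ z.1) z.2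
      have h4 := l_nonneg (h (comp θ) z.1) z.2
      have h5 := le_abs_self M
      rw [hgdef, abs_le]
      constructor <;> simp only <;> linarith
    have hgK : ∀ᵐ z ∂D, g θ z ^ 2 ≤ K * ∫ z, g θ z ∂D := by
      rw [hint]
      exact hcompK θ hθΘ hpos
    refine (hR.measure_weightedSum_le hh hκ hT hg hgM hgK hr.le hrM hrK
      (by rw [hint]; exact hpos.le) t a₀).trans ?_
    apply ENNReal.ofReal_le_ofReal
    rw [hint, ← Real.le_log_iff_exp_le (by positivity),
      Real.log_div hδ.ne' hBd.ne', hlogBd]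
    have h1 : r * a₀ ≤ a₀ := by
      refine mul_le_of_le_one_left ha₀ ?_
      rw [hrdef, div_le_one (by positivity)]
      linarith
    have h2 : c₁ * Λ ≤ t * (r * ex θ / 2) := by
      calc c₁ * Λ = t * (r * thr / 2) := by rw [hthrdef, hrdef]; field_simp
        _ ≤ t * (r * ex θ / 2) := by gcongr
    have h3 : Real.log δ = -Real.log (1 / δ) := by rw [one_div, Real.log_inv, neg_neg]
    have h4 : a₀ + k * Real.log Kn + 2 * k * Real.log T + Real.log (1 / δ) ≤ c₁ * Λ := by
      rw [hΛdef, hlog, hc₁def]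
      have hk : (0 : ℝ) ≤ k := k.cast_nonneg
      have h5 : 0 ≤ k * Real.log Kn := by positivity
      have h6 : (a₀ + k * Real.log Kn + 2 * k + 1) * (1 + (Real.log T + Real.log (1 / δ))) =
          a₀ + k * Real.log Kn + 2 * k * Real.log T + Real.log (1 / δ) +
            (a₀ * (Real.log T + Real.log (1 / δ)) +
              k * Real.log Kn * (Real.log T + Real.log (1 / δ)) + 2 * k * Real.log (1 / δ) +
              2 * k + 1 + Real.log T) := by ring
      rw [h6]
      exact le_add_of_nonneg_right (by positivity)
    linarith
  have hgood : ∀ᵐ ω ∂P, (∀ θ' ∈ Θ, R.empRisk N S l h κ T t ω (R.θ t ω) ≤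
      R.empRisk N S l h κ T t ω θ') ∧ (∀ i, (R.warmup i ω).2 ∈ 𝒞) ∧
      ∀ s, (R.sample (s + 1) ω).2 ∈ 𝒞 :=
    (hR.θ_argmin t).and ((ae_all_iff.2 fun i => hR.ae_warmup hD𝒞 i).and
      (ae_all_iff.2 fun s => hR.ae_sample hD𝒞 s))
  have hexlip : ∀ θ ∈ Θ, ∀ θ' ∈ Θ, ‖θ - θ'‖ ≤ 1 / (T : ℝ) ^ 2 →
      ex θ ≤ ex θ' + L * (1 / (T : ℝ) ^ 2) := by
    intro θ hθ θ' hθ' hη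
    have h1 := risk_le_risk_add hD𝒞 h_meas hL₁ l_meas l_nonneg hM hL₂ hθ hθ'
    have h2 : L * ‖θ - θ'‖ ≤ L * (1 / (T : ℝ) ^ 2) := mul_le_mul_of_nonneg_left hη hL
    simp only [hexdef]
    linarith
  -- If `h_t` has large excess risk, so has the nearby net point; the summand `L` in the constant
  -- pays for the difference. The union runs over net points of excess above `thr > 0`, where
  -- comparators exist.
  have hsub : ({ω | (2 * c₁ / c₀ + L) * Λ * A / t < ex (R.θ t ω)} : Set Ω) ≤ᵐ[P]
      ⋃ θ ∈ F.filter fun θ => thr < ex θ, E θ := by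
    filter_upwards [hgood] with ω hω hbad
    obtain ⟨hargmin, hwarm, hsample⟩ := hω
    obtain ⟨θ, hθF, hθ⟩ := hFnet (R.θ t ω) (hR.θ_mem t ω)
    have hbad : (2 * c₁ / c₀ + L) * Λ * A / t < ex (R.θ t ω) := hbad
    have h1 := hexlip _ (hR.θ_mem t ω) θ (hFΘ θ hθF) hθ
    have h2 : L * (1 / (T : ℝ) ^ 2) ≤ L * Λ * A / t := by
      rw [mul_assoc L, mul_div_assoc]
      refine mul_le_mul_of_nonneg_left ?_ hL
      rw [div_le_div_iff₀ (by positivity) ht0]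
      exact mul_le_mul (one_le_mul_of_one_le_of_one_le hΛ1 hA1)
        (htT'.trans (le_self_pow₀ hT1 two_ne_zero)) ht0.le (by positivity)
    have h3 : (2 * c₁ / c₀ + L) * Λ * A / t = thr + L * Λ * A / t := by
      rw [hthrdef]; ring
    have hex : thr < ex θ := by linarith
    refine Set.mem_iUnion₂.2 ⟨θ, Finset.mem_filter.2 ⟨hθF, hex⟩, ?_⟩
    have h4 := hR.weightedSum_le_of_argmin hn₀ hκ hT l_nonneg hM hL₁ hL₂ hargmin hwarm hsample
      (hFΘ θ hθF) (hcompΘ θ (hFΘ θ hθF) (hthr.trans hex)) hθ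
    refine h4.trans ?_
    rw [ha₀def]
    refine add_le_add (mul_le_mul_of_nonneg_left (le_abs_self M) n₀.cast_nonneg) ?_
    rw [← hLdef, ← hAdef]
    have h5 : (t : ℝ) * A * (1 / (T : ℝ) ^ 2) ≤ 1 := by
      rw [mul_one_div, div_le_one (by positivity), sq]
      exact mul_le_mul htT' hAT (by positivity) hT0.le
    calc (t : ℝ) * (A * (L * (1 / (T : ℝ) ^ 2))) = t * A * (1 / (T : ℝ) ^ 2) * L := by ring
      _ ≤ 1 * L := mul_le_mul_of_nonneg_right h5 hL
      _ = L := one_mul L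
  refine (measure_mono_ae hsub).trans ((measure_biUnion_finset_le _ _).trans ?_)
  refine (Finset.sum_le_card_nsmul _ _ (ENNReal.ofReal (δ / Bd)) fun θ hθ =>
    hE θ (Finset.mem_filter.1 hθ).1 (Finset.mem_filter.1 hθ).2).trans ?_
  rw [nsmul_eq_mul, ← ENNReal.ofReal_natCast, ← ENNReal.ofReal_mul (Nat.cast_nonneg _)]
  apply ENNReal.ofReal_le_ofReal
  have h1 : ((F.filter fun θ => thr < ex θ).card : ℝ) ≤ Bd :=
    le_trans (by exact_mod_cast Finset.card_filter_le _ _) hFcard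
  rw [mul_div_assoc', div_le_iff₀ hBd, mul_comm δ]
  exact mul_le_mul_of_nonneg_right h1 hδ.le

/-! ### The probability of acquiring a label -/

section Step

variable {𝒳 : Type*} [MeasurableSpace 𝒳] {d k : ℕ} {Θ : Set (Fin k → ℝ)}
  {h : (Fin k → ℝ) → 𝒳 → Fin d → ℝ}

/-- As `ν_S` is 1-Lipschitz, closeness of `h_t(x)` to degeneracy within `b` forces that of the
comparator within `b + r`, and the margin condition applies. -/
theorem measure_stepNear_le {N : Seminorm ℝ (Fin d → ℝ)} {S : Set (Fin d → ℝ)} {μ : Measure 𝒳}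
    [IsProbabilityMeasure μ] {Hopt : Set (𝒳 → Fin d → ℝ)} {κ κ' β : ℝ} (hβ : 0 < β)
    (hκ' : 0 < κ') (hκκ' : κ' ≤ κ)
    (hmargin : ∀ b : ℝ, 0 ≤ b → nearDegeneracy N S μ Hopt b ≤ (b / β) ^ κ)
    {n₀ t : ℕ} {q : Θ × Θ × ℝ × ℝ} (hq : h q.2.1 ∈ Hopt) {b r : ℝ} (hb : 0 ≤ b) (hr : 0 ≤ r)
    (hqb : threshold q.2.2.2 n₀ t ≤ b) (hqr : ∀ᵐ x ∂μ, N (h q.1 x - h q.2.1 x) ≤ r) :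
    μ {x | stepNear N S h n₀ t q x} ≤ ENNReal.ofReal (((b + r) / β) ^ κ') := by
  have h1 : μ {x | stepNear N S h n₀ t q x} ≤
      μ {x | ⨅ f ∈ Hopt, nu N S (f x) ≤ ENNReal.ofReal (b + r)} := by
    refine measure_mono_ae ?_
    filter_upwards [hqr] with x hx hnear
    have hnear : nu N S (h q.1 x) < ENNReal.ofReal (threshold q.2.2.2 n₀ t) := hnear
    refine (iInf₂_le (h q.2.1) hq).trans ((nu_le_nu_add N S (h q.1 x) (h q.2.1 x)).trans ?_)
    rw [ENNReal.ofReal_add hb hr]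
    exact add_le_add (hnear.le.trans (ENNReal.ofReal_le_ofReal hqb)) (ENNReal.ofReal_le_ofReal hx)
  refine h1.trans ?_
  rw [← ofReal_measureReal]
  apply ENNReal.ofReal_le_ofReal
  exact (le_min measureReal_le_one (hmargin (b + r) (by positivity))).trans
    (min_one_rpow_le (by positivity) hκ' hκκ')

theorem softProb_le {κ κ' : ℝ} (hκ'₀ : 0 < κ') (hκ'₁ : κ' ≤ 1) (T : ℕ) {α r αhi r' : ℝ}
    (hα : α ≤ αhi) (hαhi : 0 ≤ αhi) (hr : 0 ≤ r) (hrr' : r ≤ r') :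
    softProb κ T α r ≤ (T : ℝ) ^ (-(κ / (2 * (κ + 2)))) + (αhi * r') ^ κ' := by
  have hy : 0 ≤ αhi * r' := mul_nonneg hαhi (hr.trans hrr')
  have h1 : α * r ≤ αhi * r' := mul_le_mul hα hrr' hr hαhi
  have h2 := min_one_rpow_le hy hκ'₀ hκ'₁
  rw [Real.rpow_one] at h2
  have h3 : 0 ≤ (T : ℝ) ^ (-(κ / (2 * (κ + 2)))) := by positivity
  have h4 : 0 ≤ (αhi * r') ^ κ' := by positivity
  unfold softProb
  rcases le_total (α * r) ((T : ℝ) ^ (-(κ / (2 * (κ + 2))))) with h | h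
  · rw [max_eq_left h]
    exact (min_le_right _ _).trans (by linarith)
  · rw [max_eq_right h]
    exact ((min_le_min_left 1 h1).trans h2).trans (by linarith)

theorem measure_label_le {N : Seminorm ℝ (Fin d → ℝ)} {S : Set (Fin d → ℝ)}
    {D : Measure (𝒳 × (Fin d → ℝ))} [IsProbabilityMeasure D]
    (hh : Measurable fun p : Θ × 𝒳 => h p.1 p.2)
    {Hopt : Set (𝒳 → Fin d → ℝ)} {κ κ' β : ℝ} (hβ : 0 < β)
    (hκ' : 0 < κ') (hκ'₁ : κ' ≤ 1) (hκκ' : κ' ≤ κ)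
    (hmargin : ∀ b : ℝ, 0 ≤ b → nearDegeneracy N S (D.map Prod.fst) Hopt b ≤ (b / β) ^ κ)
    (T : ℕ) {n₀ t : ℕ} {q : Θ × Θ × ℝ × ℝ} (hq : h q.2.1 ∈ Hopt) {αhi : ℝ} (hαhi : 0 ≤ αhi)
    (hqα : q.2.2.1 ≤ αhi) {b r : ℝ} (hb : 0 ≤ b) (hr : 0 ≤ r)
    (hqb : threshold q.2.2.2 n₀ t ≤ b)
    (hqr : ∀ᵐ x ∂(D.map Prod.fst), N (h q.1 x - h q.2.1 x) ≤ r) :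
    (D.prod (volume.restrict (Set.Icc (0 : ℝ) 1)))
        {z | stepNear N S h n₀ t q z.1.1 ∨ z.2 ≤ stepProb N h κ T q z.1.1}
      ≤ ENNReal.ofReal ((T : ℝ) ^ (-(κ / (2 * (κ + 2)))) + ((b + r) / β) ^ κ'
          + (αhi * r) ^ κ') := by
  have : IsProbabilityMeasure (D.map Prod.fst) :=
    Measure.isProbabilityMeasure_map measurable_fst.aemeasurable
  have hnear : (D.prod (volume.restrict (Set.Icc (0 : ℝ) 1))) {z | stepNear N S h n₀ t q z.1.1}
      ≤ ENNReal.ofReal (((b + r) / β) ^ κ') := by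
    have hA : MeasurableSet {x | stepNear N S h n₀ t q x} :=
      (measurableSet_stepNear hh N S n₀ t).preimage (measurable_prodMk_left (x := q))
    have h1 := measure_stepNear_le hβ hκ' hκκ' hmargin hq hb hr hqb hqr
    rw [Measure.map_apply measurable_fst hA] at h1
    refine le_trans (le_of_eq ?_) h1
    have h2 : D = (D.prod (volume.restrict (Set.Icc (0 : ℝ) 1))).map Prod.fst := by
      rw [Measure.map_fst_prod, measure_univ, one_smul]
    conv_rhs => rw [h2]
    rw [Measure.map_apply measurable_fst (measurable_fst hA)]
    rfl
  have hheads : (D.prod (volume.restrict (Set.Icc (0 : ℝ) 1)))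
        {z | z.2 ≤ stepProb N h κ T q z.1.1}
      ≤ ENNReal.ofReal ((T : ℝ) ^ (-(κ / (2 * (κ + 2)))) + (αhi * r) ^ κ') := by
    have hmeas : MeasurableSet {z : (𝒳 × (Fin d → ℝ)) × ℝ | z.2 ≤ stepProb N h κ T q z.1.1} :=
      (measurableSet_stepHeads hh N κ T).preimage
        (measurable_const.prodMk (measurable_fst.fst.prodMk measurable_snd) :
          Measurable fun z : (𝒳 × (Fin d → ℝ)) × ℝ => (q, z.1.1, z.2))
    rw [Measure.prod_apply hmeas]
    have h1 : ∀ᵐ z ∂D, (volume.restrict (Set.Icc (0 : ℝ) 1))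
        (Prod.mk z ⁻¹' {z | z.2 ≤ stepProb N h κ T q z.1.1}) ≤
        ENNReal.ofReal ((T : ℝ) ^ (-(κ / (2 * (κ + 2)))) + (αhi * r) ^ κ') := by
      filter_upwards [ae_of_ae_map measurable_fst.aemeasurable hqr] with z hz
      have h2 : Prod.mk z ⁻¹' {z | z.2 ≤ stepProb N h κ T q z.1.1} =
          Set.Iic (stepProb N h κ T q z.1) := rfl
      have h3 : stepProb N h κ T q z.1 ≤ 1 := softProb_le_one κ T q.2.2.1 _
      rw [h2, volume_Icc_inter_Iic h3]
      exact ENNReal.ofReal_le_ofReal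
        (softProb_le hκ' hκ'₁ T hqα hαhi (apply_nonneg N _) hz)
    refine (lintegral_mono_ae h1).trans ?_
    simp
  have hpos1 : 0 ≤ ((b + r) / β) ^ κ' := by positivity
  have hpos2 : 0 ≤ (αhi * r) ^ κ' := by positivity
  have hpos3 : 0 ≤ (T : ℝ) ^ (-(κ / (2 * (κ + 2)))) := by positivity
  rw [Set.ofPred_or]
  refine (measure_union_le _ _).trans ((add_le_add hnear hheads).trans (le_of_eq ?_))
  rw [← ENNReal.ofReal_add hpos1 (by positivity)]
  congr 1
  ring

end Step

namespace Run.IsExecution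

variable {Ω : Type*} [MeasurableSpace Ω] {𝒳 : Type*} {d k n₀ : ℕ}
  [MeasurableSpace 𝒳] {R : Run Ω 𝒳 d k n₀} {P : Measure Ω}
  {D : Measure (𝒳 × (Fin d → ℝ))} {N : Seminorm ℝ (Fin d → ℝ)} {S : Set (Fin d → ℝ)}
  {l : (Fin d → ℝ) → (Fin d → ℝ) → ℝ} {Θ : Set (Fin k → ℝ)}
  {h : (Fin k → ℝ) → 𝒳 → Fin d → ℝ} {κ αlo αhi : ℝ} {T : ℕ}

theorem measurableSet_label (hR : R.IsExecution P D N S l Θ h κ αlo αhi T)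
    (hh : Measurable fun p : Θ × 𝒳 => h p.1 p.2) (t : ℕ) :
    MeasurableSet {ω | R.nearMargin N S h t ω ∨ R.heads N h κ T t ω} := by
  have h2 : Measurable (R.state hR.θ_mem hR.θstar_mem t) :=
    (hR.measurable_state t).mono (R.hist.le _) le_rfl
  have h3 : Measurable fun ω => (R.sample (t + 1) ω, R.coin (t + 1) ω) :=
    (hR.measurable_data t).mono (R.hist.le _) le_rfl
  exact ((measurableSet_stepNear hh N S n₀ t).preimage (h2.prodMk h3.fst.fst)).union
    ((measurableSet_stepHeads hh N κ T).preimage (h2.prodMk (h3.fst.fst.prodMk h3.snd)))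

variable [IsProbabilityMeasure P]

theorem integral_numLabels (hR : R.IsExecution P D N S l Θ h κ αlo αhi T)
    (hh : Measurable fun p : Θ × 𝒳 => h p.1 p.2) (t : ℕ) :
    ∫ ω, R.numLabels N S h κ T t ω ∂P =
      n₀ + ∑ s ∈ Finset.range t, P.real {ω | R.nearMargin N S h s ω ∨ R.heads N h κ T s ω} := by
  classical
  have hi : ∀ s, (fun ω => if R.nearMargin N S h s ω ∨ R.heads N h κ T s ω then (1 : ℝ) else 0)
      = {ω | R.nearMargin N S h s ω ∨ R.heads N h κ T s ω}.indicator 1 := by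
    intro s
    ext ω
    simp [Set.indicator_apply]
  have hint : ∀ s, Integrable
      (fun ω => if R.nearMargin N S h s ω ∨ R.heads N h κ T s ω then (1 : ℝ) else 0) P := by
    intro s
    rw [hi s]
    exact (integrable_const (1 : ℝ)).indicator (hR.measurableSet_label hh s)
  have h1 : ∫ ω, R.numLabels N S h κ T t ω ∂P = ∫ ω, ((n₀ : ℝ) + ∑ s ∈ Finset.range t,
      if R.nearMargin N S h s ω ∨ R.heads N h κ T s ω then (1 : ℝ) else 0) ∂P := by
    refine integral_congr_ae (Eventually.of_forall fun ω => ?_)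
    simp only [numLabels]
  rw [h1, integral_add (integrable_const _) (integrable_finsetSum _ fun s _ => hint s),
    integral_finsetSum _ fun s _ => hint s]
  simp only [integral_const, probReal_univ, one_smul]
  congr 1
  refine Finset.sum_congr rfl fun s _ => ?_
  rw [hi s, integral_indicator_one (hR.measurableSet_label hh s)]

/-- Passes from a bound on the conditional probability given the state, valid off `bad`, to the
unconditional one. -/
theorem measure_label_le (hR : R.IsExecution P D N S l Θ h κ αlo αhi T)
    [IsProbabilityMeasure D] (hh : Measurable fun p : Θ × 𝒳 => h p.1 p.2) {t : ℕ} {Q : ℝ≥0∞}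
    {bad : Set Ω} (hQ : ∀ ω ∉ bad, (D.prod (volume.restrict (Set.Icc (0 : ℝ) 1)))
      {z | stepNear N S h n₀ t (R.state hR.θ_mem hR.θstar_mem t ω) z.1.1 ∨
        z.2 ≤ stepProb N h κ T (R.state hR.θ_mem hR.θstar_mem t ω) z.1.1} ≤ Q) :
    P {ω | R.nearMargin N S h t ω ∨ R.heads N h κ T t ω} ≤ Q + P bad := by
  set G : Set ((Θ × Θ × ℝ × ℝ) × (𝒳 × (Fin d → ℝ)) × ℝ) :=
    {p | stepNear N S h n₀ t p.1 p.2.1.1 ∨ p.2.2 ≤ stepProb N h κ T p.1 p.2.1.1} with hG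
  have hGm : MeasurableSet G :=
    ((measurableSet_stepNear hh N S n₀ t).preimage
      (measurable_fst.prodMk measurable_snd.fst.fst)).union
    ((measurableSet_stepHeads hh N κ T).preimage
      (measurable_fst.prodMk (measurable_snd.fst.fst.prodMk measurable_snd.snd)))
  have key := hR.lintegral_step t (hR.measurable_state t)
    (f := G.indicator fun _ => 1) (measurable_const.indicator hGm)
  have hlhs : ∫⁻ ω, G.indicator (fun _ => (1 : ℝ≥0∞)) (R.state hR.θ_mem hR.θstar_mem t ω,
      (R.sample (t + 1) ω, R.coin (t + 1) ω)) ∂P =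
      P {ω | R.nearMargin N S h t ω ∨ R.heads N h κ T t ω} :=
    lintegral_indicator_one (hR.measurableSet_label hh t)
  rw [← hlhs, key]
  have hslice : ∀ ω, ∫⁻ z, G.indicator (fun _ => (1 : ℝ≥0∞))
      (R.state hR.θ_mem hR.θstar_mem t ω, z) ∂(D.prod (volume.restrict (Set.Icc (0 : ℝ) 1))) =
      (D.prod (volume.restrict (Set.Icc (0 : ℝ) 1)))
      {z | stepNear N S h n₀ t (R.state hR.θ_mem hR.θstar_mem t ω) z.1.1 ∨
        z.2 ≤ stepProb N h κ T (R.state hR.θ_mem hR.θstar_mem t ω) z.1.1} := fun ω =>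
    lintegral_indicator_one (hGm.preimage (measurable_prodMk_left
      (x := R.state hR.θ_mem hR.θstar_mem t ω)))
  simp only [hslice]
  -- `bad` is not assumed measurable, so its measurable hull, of the same measure, is used.
  refine (lintegral_mono (g := fun ω => Q + (toMeasurable P bad).indicator 1 ω) fun ω => ?_).trans ?_
  · by_cases hω : ω ∈ toMeasurable P bad
    · simp only [Set.indicator_of_mem hω, Pi.one_apply]
      exact prob_le_one.trans le_add_self
    · exact (hQ ω fun hb => hω (subset_toMeasurable P bad hb)).trans le_self_add
  · rw [lintegral_add_left measurable_const, lintegral_const, measure_univ, mul_one,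
      lintegral_indicator_one (measurableSet_toMeasurable P bad), measure_toMeasurable]

end Run.IsExecution

/-! ### Elementary estimates -/

theorem threshold_le {n₀ t T : ℕ} (hn₀ : 1 ≤ n₀) (ht : 1 ≤ t) (htT : t ≤ T) {b b' Λ : ℝ}
    (hb : 0 ≤ b) (hbb' : b ≤ b') (hΛ : 1 + Real.log T ≤ Λ) :
    threshold b n₀ t ≤ b' * (n₀ * (1 + Real.log (2 * n₀)) * Λ) * (t : ℝ) ^ (-(1 / 4 : ℝ)) := by
  have hn1 : (1 : ℝ) ≤ n₀ := by exact_mod_cast hn₀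
  have ht1 : (1 : ℝ) ≤ t := by exact_mod_cast ht
  have htT' : (t : ℝ) ≤ T := by exact_mod_cast htT
  have hT1 : (1 : ℝ) ≤ T := ht1.trans htT'
  have hlogn : 0 ≤ Real.log (2 * n₀) := Real.log_nonneg (by linarith)
  have hlogT : 0 ≤ Real.log T := Real.log_nonneg hT1
  have hlog : Real.log ((n₀ : ℝ) + t) ≤ (1 + Real.log (2 * n₀)) * Λ := by
    have h1 : (n₀ : ℝ) + t ≤ 2 * n₀ * T := by nlinarith
    have h2 := Real.log_le_log (by linarith) h1
    rw [Real.log_mul (by positivity) (by positivity)] at h2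
    have h3 := mul_le_mul_of_nonneg_left hΛ (by linarith : 0 ≤ 1 + Real.log (2 * n₀))
    nlinarith [mul_nonneg hlogn hlogT]
  have hΛ1 : 1 ≤ Λ := by linarith
  set Cn : ℝ := n₀ * (1 + Real.log (2 * n₀)) * Λ with hCn
  have hCn1 : 1 ≤ Cn :=
    one_le_mul_of_one_le_of_one_le (one_le_mul_of_one_le_of_one_le hn1 (by linarith)) hΛ1
  have hlog0 : 0 ≤ Real.log ((n₀ : ℝ) + t) := Real.log_nonneg (by linarith)
  have h1 : ((n₀ : ℝ) * Real.log ((n₀ : ℝ) + t) / t) ^ (1 / 4 : ℝ) ≤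
      Cn * (t : ℝ) ^ (-(1 / 4 : ℝ)) := by
    calc ((n₀ : ℝ) * Real.log ((n₀ : ℝ) + t) / t) ^ (1 / 4 : ℝ) ≤ (Cn / t) ^ (1 / 4 : ℝ) := by
          refine Real.rpow_le_rpow (by positivity) ?_ (by norm_num)
          gcongr
          rw [hCn, mul_assoc]
          exact mul_le_mul_of_nonneg_left hlog (by positivity)
      _ = Cn ^ (1 / 4 : ℝ) * (t : ℝ) ^ (-(1 / 4 : ℝ)) := by
          rw [Real.div_rpow (by positivity) (by positivity), Real.rpow_neg (by positivity)]
          rfl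
      _ ≤ Cn * (t : ℝ) ^ (-(1 / 4 : ℝ)) := by
          refine mul_le_mul_of_nonneg_right ?_ (by positivity)
          exact Real.rpow_le_self_of_one_le hCn1 (by norm_num)
  unfold threshold
  rw [if_neg (by omega), mul_assoc]
  exact mul_le_mul hbb' h1 (by positivity) (hb.trans hbb')

/-- The decay `t ^ (-1/2)` is weakened to `t ^ (-1/4)` on purpose: the rejection threshold decays no
faster. -/
theorem sqrt_mul_div_le {C Λ A t : ℝ} (hC : 0 ≤ C) (hΛ : 1 ≤ Λ) (hA : 0 ≤ A) (ht : 1 ≤ t) :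
    √(C * Λ * A / t) ≤ √C * Λ * (√A * t ^ (-(1 / 4 : ℝ))) := by
  have ht0 : 0 < t := by linarith
  refine Real.sqrt_le_iff.2 ⟨by positivity, ?_⟩
  have h1 : (√C * Λ * (√A * t ^ (-(1 / 4 : ℝ)))) ^ 2 = C * Λ ^ 2 * A * (t ^ (-(1 / 4 : ℝ))) ^ 2 := by
    rw [mul_pow, mul_pow, mul_pow, Real.sq_sqrt hC, Real.sq_sqrt hA]
    ring
  have h2 : 1 / t ≤ (t ^ (-(1 / 4 : ℝ))) ^ 2 := by
    rw [← Real.rpow_natCast, ← Real.rpow_mul ht0.le, one_div, ← Real.rpow_neg_one]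
    exact Real.rpow_le_rpow_of_exponent_le ht (by norm_num)
  rw [h1, div_eq_mul_one_div]
  have h3 : Λ ≤ Λ ^ 2 := by nlinarith
  gcongr

/-- The `3` collects the soft-rejection floor, the failure probabilities `1 / T`, and the term `t =
0`, for which there is only the trivial bound. The factor `2` bounds `1 / (1 - κ' / 4)`. -/
theorem sum_label_le {κ κ' : ℝ} (hκ : 0 < κ) (hκ' : 0 < κ') (hκ'₁ : κ' ≤ 1) (hκκ' : κ' ≤ κ)
    {T : ℕ} (hT : 1 ≤ T) {c : ℝ} (hc : 0 ≤ c) {p : ℕ → ℝ} (hp₁ : p 0 ≤ 1)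
    (hp : ∀ t : ℕ, 1 ≤ t → t < T → p t ≤ (T : ℝ) ^ (-(κ / (2 * (κ + 2)))) +
      c * ((T : ℝ) ^ (κ * κ' / (4 * (κ + 2))) * (t : ℝ) ^ (-(κ' / 4))) + 1 / T) :
    ∑ t ∈ Finset.range T, p t ≤ (3 + 2 * c) * (T : ℝ) ^ (1 - κ' / (2 * (κ + 2))) := by
  obtain ⟨n, rfl⟩ : ∃ n, T = n + 1 := ⟨T - 1, by omega⟩
  set X : ℝ := ((n + 1 : ℕ) : ℝ) with hX
  have hX1 : 1 ≤ X := Nat.one_le_cast.2 hT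
  have hX0 : 0 < X := by linarith
  have hnX : (n : ℝ) ≤ X := by rw [hX]; push_cast; linarith
  have hκ2 : 0 < κ + 2 := by linarith
  set e : ℝ := 1 - κ' / (2 * (κ + 2)) with he
  have he0 : 0 ≤ e := by
    rw [he, sub_nonneg, div_le_one (by positivity)]
    linarith
  have hXe : 1 ≤ X ^ e := Real.one_le_rpow hX1 he0
  have hsum : ∑ t ∈ Finset.range n, ((t : ℝ) + 1) ^ (-(κ' / 4)) ≤ 2 * X ^ (1 - κ' / 4) := by
    refine (sum_rpow_neg_le (by positivity) (by linarith) n).trans ?_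
    have h1 : (n : ℝ) ^ (1 - κ' / 4) ≤ X ^ (1 - κ' / 4) :=
      Real.rpow_le_rpow n.cast_nonneg hnX (by linarith)
    rw [div_le_iff₀ (by linarith)]
    have h2 : 0 ≤ X ^ (1 - κ' / 4) := by positivity
    nlinarith
  have h1 : ∑ t ∈ Finset.range n, p (t + 1) ≤ ∑ t ∈ Finset.range n,
      (X ^ (-(κ / (2 * (κ + 2)))) + c * X ^ (κ * κ' / (4 * (κ + 2))) *
        ((t : ℝ) + 1) ^ (-(κ' / 4)) + 1 / X) := by
    refine Finset.sum_le_sum fun t ht => ?_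
    have := hp (t + 1) (by omega) (by have := Finset.mem_range.1 ht; omega)
    rw [← mul_assoc] at this
    simpa only [Nat.cast_add, Nat.cast_one, hX] using this
  rw [Finset.sum_add_distrib, Finset.sum_add_distrib, ← Finset.mul_sum, Finset.sum_const,
    Finset.sum_const, Finset.card_range, nsmul_eq_mul, nsmul_eq_mul] at h1
  have h2 : (n : ℝ) * X ^ (-(κ / (2 * (κ + 2)))) ≤ X ^ e := by
    calc (n : ℝ) * X ^ (-(κ / (2 * (κ + 2)))) ≤ X * X ^ (-(κ / (2 * (κ + 2)))) := by gcongr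
      _ = X ^ (1 + -(κ / (2 * (κ + 2)))) := by rw [Real.rpow_add hX0, Real.rpow_one]
      _ ≤ X ^ e := by
        refine Real.rpow_le_rpow_of_exponent_le hX1 ?_
        rw [he, ← sub_eq_add_neg]
        gcongr
  have h3 : (n : ℝ) * (1 / X) ≤ 1 := by rwa [mul_one_div, div_le_one hX0]
  have h4 : c * X ^ (κ * κ' / (4 * (κ + 2))) * ∑ t ∈ Finset.range n, ((t : ℝ) + 1) ^ (-(κ' / 4))
      ≤ 2 * c * X ^ e := by
    calc _ ≤ c * X ^ (κ * κ' / (4 * (κ + 2))) * (2 * X ^ (1 - κ' / 4)) := by gcongr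
      _ = 2 * c * (X ^ (κ * κ' / (4 * (κ + 2))) * X ^ (1 - κ' / 4)) := by ring
      _ = 2 * c * X ^ e := by
        rw [← Real.rpow_add hX0]
        congr 2
        rw [he]
        field_simp
        ring
  rw [Finset.sum_range_succ']
  linarith

theorem mul_rpow_le_mul_rpow {c y κ' : ℝ} (hc : 1 ≤ c) (hy : 0 ≤ y) (hκ'₁ : κ' ≤ 1) :
    (c * y) ^ κ' ≤ c * y ^ κ' := by
  rw [Real.mul_rpow (by linarith) hy]
  exact mul_le_mul_of_nonneg_right (Real.rpow_le_self_of_one_le hc hκ'₁) (by positivity)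

end MBAL

/-! ### The risk bound and the label complexity -/

theorem proposition5
    {𝒳 : Type*} [MeasurableSpace 𝒳] {d k n₀ : ℕ} (hn₀ : 1 ≤ n₀)
    -- the generic norm, the feasible region, and the optimization oracle
    (N : Seminorm ℝ (Fin d → ℝ)) (hN : ∀ v, N v = 0 → v = 0)
    (S : Set (Fin d → ℝ)) (hS : MBAL.IsPolyhedron S)
    (wstar : (Fin d → ℝ) → Fin d → ℝ) (hwstar : ∀ c, MBAL.IsOptimal S c (wstar c))
    (hwstar_meas : Measurable wstar)
    -- the law of (feature vector, cost vector), with bounded cost vectors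
    (D : Measure (𝒳 × (Fin d → ℝ))) [IsProbabilityMeasure D]
    (𝒞 : Set (Fin d → ℝ)) (h𝒞 : Bornology.IsBounded 𝒞) (hD𝒞 : ∀ᵐ z ∂D, z.2 ∈ 𝒞)
    -- the hypothesis class, smoothly parameterized by a bounded set
    (Θ : Set (Fin k → ℝ)) (hΘ : Bornology.IsBounded Θ)
    (h : (Fin k → ℝ) → 𝒳 → Fin d → ℝ) (h_meas : ∀ θ ∈ Θ, Measurable (h θ))
    (L₁ : ℝ) (hL₁ : ∀ θ₁ ∈ Θ, ∀ θ₂ ∈ Θ, ∀ x, ‖h θ₁ x - h θ₂ x‖ ≤ L₁ * ‖θ₁ - θ₂‖)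
    -- the surrogate loss: bounded, and Lipschitz in the prediction, on the relevant vectors
    (l : (Fin d → ℝ) → (Fin d → ℝ) → ℝ) (l_meas : Measurable (Function.uncurry l))
    (l_nonneg : ∀ chat c, 0 ≤ l chat c)
    (M : ℝ) (hM : ∀ θ ∈ Θ, ∀ x, ∀ c ∈ 𝒞, l (h θ x) c ≤ M)
    (L₂ : ℝ) (hL₂ : ∀ θ₁ ∈ Θ, ∀ θ₂ ∈ Θ, ∀ x₁ x₂, ∀ c ∈ 𝒞,
      |l (h θ₁ x₁) c - l (h θ₂ x₂) c| ≤ L₂ * ‖h θ₁ x₁ - h θ₂ x₂‖)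
    -- consistency and error bound condition
    (φ : ℝ → ℝ) (hφ : MBAL.ConsistencyErrorBound N D wstar l (h '' Θ) φ)
    -- margin condition
    (κ β : ℝ) (hκ : 0 < κ) (hβ : 0 < β)
    (hmargin : ∀ b : ℝ, 0 ≤ b →
      MBAL.nearDegeneracy N S (D.map Prod.fst) (MBAL.optSet D (MBAL.spoLoss wstar) (h '' Θ)) b
        ≤ (b / β) ^ κ)
    -- the range of the scales
    (αlo αhi : ℝ) (hαlo : 0 < αlo) (hα : αlo ≤ αhi) :
    -- the order of magnitude allowed for the initial threshold
    ∀ (B : ℝ) (m₀ : ℕ), ∃ C : ℝ, 0 < C ∧ ∃ m : ℕ,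
      ∀ (T : ℕ), 1 ≤ T → ∀ (δ : ℝ), 0 < δ → δ ≤ 1 →
      ∀ (Ω : Type*) [MeasurableSpace Ω] (P : Measure Ω) [IsProbabilityMeasure P]
        (R : MBAL.Run Ω 𝒳 d k n₀), R.IsExecution P D N S l Θ h κ αlo αhi T →
        1 - δ ≤ P.real {ω | MBAL.risk D l (h (R.θ T ω)) - MBAL.optRisk D l (h '' Θ)
            ≤ C * (1 + Real.log (T / δ)) ^ m * (T : ℝ) ^ (-(1 / 2 : ℝ))} ∧
        (R.StarClosest D N l Θ h →
          (∀ ω, R.b₀ ω ≤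
            B * (1 + Real.log (T / δ)) ^ m₀ * (T : ℝ) ^ (κ / (4 * (κ + 2)))) →
          ∫ ω, R.numLabels N S h κ T T ω ∂P
            ≤ C * (1 + Real.log (T / δ)) ^ m *
              (T : ℝ) ^ (1 - min κ 1 / (2 * (κ + 2)))) := by
  open MBAL in
  intro B m₀
  have hαhi : 0 < αhi := hαlo.trans_le hα
  obtain ⟨C₀, hC₀, hrate⟩ := exists_fast_rate (S := S) (αlo := αlo) (αhi := αhi) hn₀ hN hD𝒞 hΘ
    h_meas hL₁ l_meas l_nonneg hM hL₂ hφ hκ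
  obtain ⟨w, hw, hhw⟩ := exists_seminorm_predictor_sub_le N hΘ hL₁
  obtain ⟨K, hK, hdist⟩ := exists_essDist_lt hφ hw hhw
  have hh := measurable_predictor h_meas hL₁
  have hn1 : (1 : ℝ) ≤ n₀ := by exact_mod_cast hn₀
  have hlogn : 0 ≤ Real.log (2 * n₀) := Real.log_nonneg (by linarith)
  set Kr : ℝ := K * √(2 * C₀) with hKrdef
  have hKr : 0 ≤ Kr := by positivity
  set Cb : ℝ := |B| * (n₀ * (1 + Real.log (2 * n₀))) with hCbdef
  have hCb : 0 ≤ Cb := by positivity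
  -- Covers the margin term and the coin term; the summand `1` ensures `c₅ ≥ 1`, so that constants
  -- come out of the power `κ' ≤ 1`.
  set c₅ : ℝ := (Cb + Kr) / β + αhi * Kr + 1 with hc₅def
  have hc₅₁ : (Cb + Kr) / β ≤ c₅ := by
    have : 0 ≤ αhi * Kr := by positivity
    linarith
  have hc₅₂ : αhi * Kr ≤ c₅ := by
    have : 0 ≤ (Cb + Kr) / β := by positivity
    linarith
  have hc₅ : 1 ≤ c₅ := by
    have : 0 ≤ αhi * Kr := by positivity
    have : 0 ≤ (Cb + Kr) / β := by positivity
    linarith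
  -- The power `m₀` comes from `b₀`, and one more logarithm from the factor `log (n₀ + t)` in the
  -- threshold.
  refine ⟨C₀ + n₀ + 3 + 4 * c₅, by positivity, m₀ + 1, fun T hT δ hδ hδ1 Ω _ P _ R hR => ?_⟩
  have hT1 : (1 : ℝ) ≤ T := by exact_mod_cast hT
  have hT0 : (0 : ℝ) < T := by linarith
  have hlogT : 0 ≤ Real.log T := Real.log_nonneg hT1
  set Λ : ℝ := 1 + Real.log (T / δ) with hΛdef
  have hΛT : 1 + Real.log T ≤ Λ := by
    have : Real.log T ≤ Real.log (T / δ) :=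
      Real.log_le_log hT0 ((le_div_iff₀ hδ).2 (mul_le_of_le_one_right hT0.le hδ1))
    linarith
  have hΛ1 : 1 ≤ Λ := by linarith
  have hΛm : Λ ≤ Λ ^ (m₀ + 1) := le_self_pow₀ hΛ1 (Nat.succ_ne_zero m₀)
  have hΛm1 : 1 ≤ Λ ^ (m₀ + 1) := hΛ1.trans hΛm
  set A : ℝ := (T : ℝ) ^ (κ / (2 * (κ + 2))) with hAdef
  have hA : 0 < A := by positivity
  have hκ2 : 0 < κ + 2 := by linarith
  constructor
  · have hbad := hrate T hT δ hδ hδ1 Ω P R hR T hT le_rfl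
    set good := {ω | risk D l (h (R.θ T ω)) - optRisk D l (h '' Θ)
      ≤ (C₀ + n₀ + 3 + 4 * c₅) * Λ ^ (m₀ + 1) * (T : ℝ) ^ (-(1 / 2 : ℝ))} with hgood
    have hle : C₀ * Λ * A / T ≤
        (C₀ + n₀ + 3 + 4 * c₅) * Λ ^ (m₀ + 1) * (T : ℝ) ^ (-(1 / 2 : ℝ)) := by
      rw [mul_div_assoc]
      have h1 : A / T ≤ (T : ℝ) ^ (-(1 / 2 : ℝ)) := by
        rw [hAdef, ← Real.rpow_sub_one hT0.ne']
        refine Real.rpow_le_rpow_of_exponent_le hT1 ?_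
        have : κ / (2 * (κ + 2)) ≤ 1 / 2 := by
          rw [div_le_div_iff₀ (by positivity) two_pos]
          linarith
        linarith
      have h2 : C₀ ≤ C₀ + n₀ + 3 + 4 * c₅ := by linarith
      gcongr
    have hcompl : goodᶜ ⊆ {ω | C₀ * Λ * A / T < risk D l (h (R.θ T ω)) - optRisk D l (h '' Θ)} := by
      intro ω hω
      exact hle.trans_lt (not_le.1 hω)
    have h1 : P.real goodᶜ ≤ δ :=
      ENNReal.toReal_le_of_le_ofReal hδ.le ((measure_mono hcompl).trans hbad)
    -- Subadditivity alone suffices, so `good` need not be shown measurable.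
    have h2 : P.real (good ∪ goodᶜ) ≤ P.real good + P.real goodᶜ := measureReal_union_le _ _
    rw [Set.union_compl_self, probReal_univ] at h2
    linarith
  · intro hstar hb₀
    have hκ' : 0 < min κ 1 := lt_min hκ one_pos
    have hκ'₁ : min κ 1 ≤ 1 := min_le_right _ _
    have hκκ' : min κ 1 ≤ κ := min_le_left _ _
    set κ' := min κ 1
    -- The size allowed for `b₀` is `√A` up to logarithms, which puts the threshold and the
    -- prediction error on the same scale `y`.
    have hsqrtA : √A = (T : ℝ) ^ (κ / (4 * (κ + 2))) := by
      rw [Real.sqrt_eq_rpow, hAdef, ← Real.rpow_mul hT0.le]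
      congr 1
      field_simp
      norm_num
    have hstep : ∀ t : ℕ, 1 ≤ t → t < T →
        P.real {ω | R.nearMargin N S h t ω ∨ R.heads N h κ T t ω} ≤
          (T : ℝ) ^ (-(κ / (2 * (κ + 2)))) + 2 * (c₅ * Λ ^ (m₀ + 1)) *
            ((T : ℝ) ^ (κ * κ' / (4 * (κ + 2))) * (t : ℝ) ^ (-(κ' / 4))) + 1 / T := by
      intro t ht htT
      have ht1 : (1 : ℝ) ≤ t := by exact_mod_cast ht
      have ht0 : (0 : ℝ) < t := by linarith
      -- The failure probability is `1 / T` here, not `δ`: over all iterations it adds at most one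
      -- expected label.
      have hbad := hrate T hT (1 / T) (by positivity) ((div_le_one hT0).2 hT1) Ω P R hR t ht htT.le
      set e : ℝ := C₀ * (1 + Real.log (T / (1 / T))) * A / t with hedef
      set bad : Set Ω := {ω | e < risk D l (h (R.θ t ω)) - optRisk D l (h '' Θ)} with hbaddef
      have hlog2 : Real.log (T / (1 / T)) = 2 * Real.log T := by
        rw [div_div_eq_mul_div, div_one, Real.log_mul hT0.ne' hT0.ne']
        ring
      have he0 : 0 < e := by
        rw [hedef, hlog2]
        positivity
      set y : ℝ := √A * (t : ℝ) ^ (-(1 / 4 : ℝ)) with hydef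
      have hy : 0 ≤ y := by positivity
      have hyκ : y ^ κ' = (T : ℝ) ^ (κ * κ' / (4 * (κ + 2))) * (t : ℝ) ^ (-(κ' / 4)) := by
        rw [hydef, hsqrtA, Real.mul_rpow (by positivity) (by positivity), ← Real.rpow_mul hT0.le,
          ← Real.rpow_mul ht0.le]
        congr 2 <;> ring
      have hre : K * √e ≤ Kr * Λ ^ (m₀ + 1) * y := by
        have h1 : e ≤ 2 * C₀ * Λ * A / t := by
          have h2 : 1 + 2 * Real.log T ≤ 2 * Λ := by linarith
          rw [hedef, hlog2]
          calc C₀ * (1 + 2 * Real.log T) * A / t ≤ C₀ * (2 * Λ) * A / t := by gcongr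
            _ = 2 * C₀ * Λ * A / t := by ring
        calc K * √e ≤ K * (√(2 * C₀) * Λ * y) := by
              gcongr
              exact (Real.sqrt_le_sqrt h1).trans
                (sqrt_mul_div_le (by positivity) hΛ1 hA.le ht1)
          _ = Kr * Λ * y := by rw [hKrdef]; ring
          _ ≤ Kr * Λ ^ (m₀ + 1) * y := by gcongr
      have hthr : ∀ ω, threshold (R.b₀ ω) n₀ t ≤ Cb * Λ ^ (m₀ + 1) * y := by
        intro ω
        have h1 : R.b₀ ω ≤ |B| * Λ ^ m₀ * √A := by
          rw [hsqrtA]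
          refine (hb₀ ω).trans ?_
          gcongr
          exact le_abs_self B
        refine (threshold_le hn₀ ht htT.le (hR.b₀_nonneg ω) h1 hΛT).trans (le_of_eq ?_)
        rw [hCbdef, hydef]
        ring
      have hlabel := hR.measure_label_le hh (t := t) (bad := bad)
        (Q := ENNReal.ofReal ((T : ℝ) ^ (-(κ / (2 * (κ + 2)))) +
          2 * (c₅ * Λ ^ (m₀ + 1)) * y ^ κ')) fun ω hω => by
        have hex : risk D l (h (R.θ t ω)) - optRisk D l (h '' Θ) ≤ e := not_lt.1 hω
        have h1 := hdist (R.θ t ω) (hR.θ_mem t ω) e he0 hex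
        -- As `h_t^*` is a closest minimizer, the distance to the whole set of minimizers bounds the
        -- distance to `h_t^*` itself, the one that enters the coin probability.
        rw [← hstar t ω] at h1
        have h2 := ae_le_of_essNorm_lt
          (hhw _ (hR.θ_mem t ω) _ (hR.θstar_mem t ω)) h1
        refine (measure_label_le hh hβ hκ' hκ'₁ hκκ' hmargin T
          (q := R.state hR.θ_mem hR.θstar_mem t ω)
          (hφ.consistent (hR.θstar_opt t ω)) hαhi.le (hR.α_mem t ω).2
          (b := Cb * Λ ^ (m₀ + 1) * y) (r := Kr * Λ ^ (m₀ + 1) * y)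
          (by positivity) (by positivity) (hthr ω) (h2.mono fun x hx => hx.trans hre)).trans ?_
        apply ENNReal.ofReal_le_ofReal
        have hc : 1 ≤ c₅ * Λ ^ (m₀ + 1) := one_le_mul_of_one_le_of_one_le hc₅ hΛm1
        have h3 : ((Cb * Λ ^ (m₀ + 1) * y + Kr * Λ ^ (m₀ + 1) * y) / β) ^ κ' ≤
            c₅ * Λ ^ (m₀ + 1) * y ^ κ' := by
          refine le_trans (Real.rpow_le_rpow (by positivity) ?_ hκ'.le)
            (mul_rpow_le_mul_rpow hc hy hκ'₁)
          calc (Cb * Λ ^ (m₀ + 1) * y + Kr * Λ ^ (m₀ + 1) * y) / β =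
                (Cb + Kr) / β * Λ ^ (m₀ + 1) * y := by ring
            _ ≤ c₅ * Λ ^ (m₀ + 1) * y := by gcongr
        have h4 : (αhi * (Kr * Λ ^ (m₀ + 1) * y)) ^ κ' ≤ c₅ * Λ ^ (m₀ + 1) * y ^ κ' := by
          refine le_trans (Real.rpow_le_rpow (by positivity) ?_ hκ'.le)
            (mul_rpow_le_mul_rpow hc hy hκ'₁)
          calc αhi * (Kr * Λ ^ (m₀ + 1) * y) = αhi * Kr * Λ ^ (m₀ + 1) * y := by ring
            _ ≤ c₅ * Λ ^ (m₀ + 1) * y := by gcongr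
        linarith
      rw [← hyκ]
      refine ENNReal.toReal_le_of_le_ofReal (by positivity) (hlabel.trans ?_)
      exact (add_le_add le_rfl hbad).trans_eq
        (ENNReal.ofReal_add (by positivity) (by positivity)).symm
    rw [hR.integral_numLabels hh T]
    have hsum := sum_label_le hκ hκ' hκ'₁ hκκ' hT (by positivity) measureReal_le_one hstep
    have hTe : 1 ≤ (T : ℝ) ^ (1 - κ' / (2 * (κ + 2))) := by
      refine Real.one_le_rpow hT1 ?_
      rw [sub_nonneg, div_le_one (by positivity)]
      linarith
    set X : ℝ := (T : ℝ) ^ (1 - κ' / (2 * (κ + 2)))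
    set Λm : ℝ := Λ ^ (m₀ + 1)
    have h1 : (1 : ℝ) ≤ Λm * X := one_le_mul_of_one_le_of_one_le hΛm1 hTe
    have h2 : X ≤ Λm * X := le_mul_of_one_le_left (by positivity) hΛm1
    have h3 : (n₀ : ℝ) ≤ n₀ * (Λm * X) := le_mul_of_one_le_right (by positivity) h1
    have h4 : 0 ≤ C₀ * (Λm * X) := by positivity
    calc (n₀ : ℝ) + _ ≤ n₀ * (Λm * X) + (3 + 2 * (2 * (c₅ * Λm))) * X := add_le_add h3 hsum
      _ ≤ (C₀ + n₀ + 3 + 4 * c₅) * Λm * X := by linarith
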